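/- **Setting.** Let $E_j=i\lambda_j/\sqrt2$ ($1\le j\le 8$, $\lambda_j$ the Gell-Mann matrices) be the basis of $\mathfrak{su}(3)$ that is orthonormal for $\langle X|Y\rangle=\operatorname{tr}(X^\dagger Y)$, with coordinates $x_j$ and structure constants $[E_j,E_k]=\sum_l c^l_{jk}E_l$. Let $\{F,G\}=\sum_{j,k,l}c^l_{kj}\,x_l\,\partial_jF\,\partial_kG$ be the Poisson bracket on the complex polynomials $Poly(\mathfrak{su}(3))$. The dominant weights are $\omega_{(p,q)}=p\varpi_1+q\varpi_2\in\mathfrak{su}(3)$, $p,q\in\mathbb N_0$, with $\varpi_1=\frac1{\sqrt2}E_3+\frac1{\sqrt6}E_8$ and $\varpi_2=\sqrt{2/3}\,E_8$; the corresponding functional on diagonal matrices is $D\mapsto\operatorname{tr}(D(-i\omega))$, and upper triangular matrices are raising operators. Let $\xi=\sqrt{3/2}\,(x\varpi_1+y\varpi_2)$ with $x,y\ge0$, $x^2+xy+y^2=1$, be such that its adjoint orbit $\mathcal O_\xi=\{g\xi g^{-1}:g\in SU(3)\}$ is rational, i.e. a positive multiple of the orbit of some dominant weight. Put $r(\xi)=\min\{R>0: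 R\xi\text{ is a dominant weight}\}$ and $\omega_\xi=r(\xi)\xi$. Let $Poly(\mathcal O_\xi)$ be the set of restrictions to $\mathcal O_\xi$ of elements of $Poly(\mathfrak{su}(3))$, with the Poisson bracket $\{F_1|_{\mathcal O_\xi},F_2|_{\mathcal O_\xi}\}=\{F_1,F_2\}|_{\mathcal O_\xi}$. For each $s$ let $\mathcal H_s$ be an irreducible unitary representation of $SU(3)$ with highest weight $s\,\omega_\xi$, let $\rho_s:U(\mathfrak{sl}(3))\to\mathcal B(\mathcal H_s)$ be the induced representation of the universal enveloping algebra, and let $\Pi_>$ be the orthogonal projection onto the highest weight line, $\Pi_>^g=g\,\Pi_>\,g^{-1}$. The universal Berezin correspondence is $$b^s_\xi:U(\mathfrak{sl}(3))\to Poly(\mathcal O_\xi),\qquad b^s_\xi[u](g\xi g^{-1})=\operatorname{tr}(\rho_s(u)\,\Pi_>^g),$$ and the twisted product $\star^s_\xi$ on its image is given by $b^s_\xi[u]\star^s_\xi b^s_\xi[v]=b^s_\xi[uv]$. **Theorem.** For every $s\ge1$, $b^s_\xi$ and $\star^s_\xi$ are well defined, and $b^s_\xi$ takes values in $Poly(\mathcal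 O_\xi)$. Every $f\in Poly(\mathcal O_\xi)$ lies in the image of $b^s_\xi$ for all sufficiently large $s$. For all $f_1,f_2\in Poly(\mathcal O_\xi)$, as $s\to\infty$, $$f_1\star^s_\xi f_2\to f_1f_2,\qquad s\,r(\xi)\,\bigl(f_1\star^s_\xi f_2-f_2\star^s_\xi f_1\bigr)\to i\{f_1,f_2\}$$ uniformly on $\mathcal O_\xi$. That is, the Berezin fuzzy $\xi$-orbit is of Poisson type. -/

import Mathlib

open scoped Matrix

noncomputable section

namespace Quark

attribute [local instance 100] LieRing.ofAssociativeRing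

/-- `3 × 3` complex matrices. -/
abbrev Mat3 : Type := Matrix (Fin 3) (Fin 3) ℂ

/-- The group `SU(3)`. -/
abbrev SU3 : Type := Matrix.specialUnitaryGroup (Fin 3) ℂ

/-- The Lie algebra `𝔰𝔩(3) = 𝔰𝔩(3, ℂ)`, the complexification of `𝔰𝔲(3)`. -/
abbrev sl3 : LieSubalgebra ℂ Mat3 := LieAlgebra.SpecialLinear.sl (Fin 3) ℂ

/-- The universal enveloping algebra `U(𝔰𝔩(3))`. -/
abbrev Usl3 : Type := UniversalEnvelopingAlgebra ℂ sl3

/-- The Gell-Mann matrices `λ₁, …, λ₈` (indexed from `0`). -/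
def gellMann : Fin 8 → Mat3 :=
  ![!![0, 1, 0; 1, 0, 0; 0, 0, 0],
    !![0, -Complex.I, 0; Complex.I, 0, 0; 0, 0, 0],
    !![1, 0, 0; 0, -1, 0; 0, 0, 0],
    !![0, 0, 1; 0, 0, 0; 1, 0, 0],
    !![0, 0, -Complex.I; 0, 0, 0; Complex.I, 0, 0],
    !![0, 0, 0; 0, 0, 1; 0, 1, 0],
    !![0, 0, 0; 0, 0, -Complex.I; 0, Complex.I, 0],
    ((1 / Real.sqrt 3 : ℝ) : ℂ) • !![1, 0, 0; 0, 1, 0; 0, 0, -2]]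

/-- The basis `E_j = i λ_j / √2` of `𝔰𝔲(3)`, orthonormal for `⟨X|Y⟩ = tr(X† Y)`. -/
def E (j : Fin 8) : Mat3 := (Complex.I / ((Real.sqrt 2 : ℝ) : ℂ)) • gellMann j

/-- The coordinates `x_j(X) = ⟨E_j|X⟩` with respect to the basis `E`. -/
def coord (X : Mat3) (j : Fin 8) : ℂ := ((E j)ᴴ * X).trace

/-- The structure constants `c^l_{jk}`: `[E_j, E_k] = ∑_l c^l_{jk} E_l`. -/
def structConst (j k l : Fin 8) : ℂ := coord (E j * E k - E k * E j) l

/-- `Poly(𝔰𝔲(3))`: complex polynomials in the coordinates `x_1, …, x_8`. -/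
abbrev PolySu3 : Type := MvPolynomial (Fin 8) ℂ

/-- The Poisson bracket on `Poly(𝔰𝔲(3))` of the bivector
`Π = ∑_{j,k,l} c^l_{kj} x_l ∂_j ⊗ ∂_k`. -/
def poissonBracket (F G : PolySu3) : PolySu3 :=
  ∑ j, ∑ k, ∑ l, MvPolynomial.C (structConst k j l) * MvPolynomial.X l *
    (MvPolynomial.pderiv j F * MvPolynomial.pderiv k G)

/-- The fundamental weight `ϖ₁`, as an element of `𝔰𝔲(3)`. -/
def fundWeight₁ : Mat3 := (1 / Real.sqrt 2 : ℝ) • E 2 + (1 / Real.sqrt 6 : ℝ) • E 7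

/-- The fundamental weight `ϖ₂`, as an element of `𝔰𝔲(3)`. -/
def fundWeight₂ : Mat3 := Real.sqrt (2 / 3) • E 7

/-- The dominant weight `ω_(p,q) = p ϖ₁ + q ϖ₂`. -/
def domWeight (p q : ℕ) : Mat3 := (p : ℝ) • fundWeight₁ + (q : ℝ) • fundWeight₂

/-- `ω ∈ 𝔰𝔲(3)` is a dominant weight. -/
def IsDominantWeight (ω : Mat3) : Prop := ∃ p q : ℕ, ω = domWeight p q

/-- `Ad_g(X) = g X g⁻¹`. -/
def Ad (g : SU3) (X : Mat3) : Mat3 := (g : Mat3) * X * ((g⁻¹ : SU3) : Mat3)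

/-- The adjoint orbit `O_ξ` of `ξ`. -/
def orbit (ξ : Mat3) : Set Mat3 := Set.range fun g : SU3 => Ad g ξ

/-- The point `Ad_g(ξ)` of `O_ξ`. -/
def orbitPt (ξ : Mat3) (g : SU3) : orbit ξ := ⟨Ad g ξ, g, rfl⟩

/-- The arc of unit vectors of the closed principal Weyl chamber: the points
`ξ_(x,y) = √(3/2) (x ϖ₁ + y ϖ₂)` with `x, y ≥ 0` and `x² + xy + y² = 1`. -/
def arc : Set Mat3 :=
  {ξ | ∃ x y : ℝ, 0 ≤ x ∧ 0 ≤ y ∧ x ^ 2 + x * y + y ^ 2 = 1 ∧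
    ξ = Real.sqrt (3 / 2) • (x • fundWeight₁ + y • fundWeight₂)}

/-- Equivalence of orbits by rescaling. -/
def OrbitEquiv (O O' : Set Mat3) : Prop :=
  ∃ α : ℝ, 0 < α ∧ Set.BijOn (fun v => α • v) O O'

/-- The points `ξ` of the arc whose orbit is rational, that is, equivalent to
the orbit of a dominant weight. -/
def rationalArc : Set Mat3 :=
  {ξ ∈ arc | ∃ p q : ℕ, OrbitEquiv (orbit (domWeight p q)) (orbit ξ)}

/-- The integral radius `r(ξ) = min {R > 0 : R ξ is a dominant weight}`. -/
def integralRadius (ξ : Mat3) : ℝ := sInf {R : ℝ | 0 < R ∧ IsDominantWeight (R • ξ)}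

/-- The first dominant weight `ω_ξ = r(ξ) ξ`. -/
def firstWeight (ξ : Mat3) : Mat3 := integralRadius ξ • ξ

/-- The restriction to `O_ξ` of a polynomial on `𝔰𝔲(3)`. -/
def restrict (ξ : Mat3) (F : PolySu3) : orbit ξ → ℂ :=
  fun X => MvPolynomial.eval (coord (X : Mat3)) F

/-- `Poly(O_ξ)`: the restrictions to `O_ξ` of the polynomials on `𝔰𝔲(3)`. -/
def polyOrbit (ξ : Mat3) : Set (orbit ξ → ℂ) := Set.range (restrict ξ)

universe u

/-- A quantum quark system with highest weight `ω`: an irreducible unitary representation of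
`SU(3)` on a finite-dimensional Hilbert space, with its infinitesimal representation,
whose highest weight is `ω`. A linear functional on the Cartan subalgebra of diagonal matrices is
identified with the element `ω` of `𝔰𝔲(3)` by `D ↦ tr(D (-iω))`. -/
structure QuarkSystem (ω : Mat3) where
  /-- the Hilbert space -/
  H : Type u
  [normed : NormedAddCommGroup H]
  [inner : InnerProductSpace ℂ H]
  [finDim : FiniteDimensional ℂ H]
  /-- the unitary representation of the group -/
  rep : SU3 →* (H ≃ₗᵢ[ℂ] H)
  /-- the induced representation of the complexified Lie algebra -/
  drep : sl3 →ₗ⁅ℂ⁆ Module.End ℂ H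
  /-- On `𝔰𝔲(3)`, `drep` is the differential of `rep` at the identity. -/
  hasDerivAt_rep : ∀ X : sl3, (X : Mat3)ᴴ = -(X : Mat3) →
    ∀ γ : ℝ → SU3, (∀ t : ℝ, (γ t : Mat3) = NormedSpace.exp (t • (X : Mat3))) →
      ∀ v : H, HasDerivAt (fun t : ℝ => rep (γ t) v) (drep X v) 0
  irreducible : ∀ W : Submodule ℂ H, (∀ g : SU3, ∀ v ∈ W, rep g v ∈ W) → W = ⊥ ∨ W = ⊤
  /-- a highest weight unit vector; it spans the highest weight subspace -/
  hwVec : H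
  norm_hwVec : ‖hwVec‖ = 1
  drep_upper : ∀ X : sl3, (∀ i j : Fin 3, j ≤ i → (X : Mat3) i j = 0) → drep X hwVec = 0
  drep_diag : ∀ X : sl3, (X : Mat3).IsDiag →
    drep X hwVec = ((X : Mat3) * (-Complex.I • ω)).trace • hwVec

attribute [instance] QuarkSystem.normed QuarkSystem.inner QuarkSystem.finDim

namespace QuarkSystem

variable {ω : Mat3} (Q : QuarkSystem.{u} ω)

/-- The representation `ρ_ω` of `U(𝔰𝔩(3))` on the Hilbert space. -/
def univRep : Usl3 →ₐ[ℂ] Module.End ℂ Q.H := UniversalEnvelopingAlgebra.lift ℂ Q.drep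

/-- The operator by which `g ∈ SU(3)` acts. -/
def op (g : SU3) : Module.End ℂ Q.H := (Q.rep g).toLinearEquiv.toLinearMap

/-- `Π_>`, the orthogonal projection onto the highest weight subspace. -/
def hwProj : Module.End ℂ Q.H := ((ℂ ∙ Q.hwVec).starProjection : Q.H →L[ℂ] Q.H)

/-- `Π_>^g = ρ(g) Π_> ρ(g)⁻¹`. -/
def hwProjAt (g : SU3) : Module.End ℂ Q.H := Q.op g * Q.hwProj * Q.op g⁻¹

/-- The Berezin correspondence `B : 𝓑(H) → Fun(O_ξ)`, `B_A(Ad_g(ξ)) = tr(A Π_>^g)`; at each point of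
the orbit some `g` is chosen. That the value does not depend on this choice, if `ω` is a positive
multiple of `ξ` in `arc`, is `IsBerezin` below. -/
def berezinSymbol (ξ : Mat3) : Module.End ℂ Q.H →ₗ[ℂ] (orbit ξ → ℂ) :=
  LinearMap.pi fun X => (LinearMap.trace ℂ Q.H).comp
    (LinearMap.mulRight ℂ (Q.hwProjAt X.2.choose))

/-- The universal Berezin correspondence `b = B ∘ ρ_ω`. -/
def univBerezin (ξ : Mat3) : Usl3 →ₗ[ℂ] (orbit ξ → ℂ) :=
  (Q.berezinSymbol ξ).comp Q.univRep.toLinearMap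

/-- `w` is a map `U(𝔰𝔩(3)) → Poly(O_ξ)` with `w[u](Ad_g(ξ)) = tr(ρ_ω(u) Π_>^g)` for all `u`, `g`. -/
def IsBerezin (ξ : Mat3) (w : Usl3 →ₗ[ℂ] (orbit ξ → ℂ)) : Prop :=
  ∀ u : Usl3, w u ∈ polyOrbit ξ ∧
    ∀ g : SU3, w u (orbitPt ξ g) = LinearMap.trace ℂ Q.H (Q.univRep u * Q.hwProjAt g)

end QuarkSystem

open Classical in
/-- The twisted product induced by `w : U(𝔰𝔩(3)) → Fun(O_ξ)` on its image: `w[u] ⋆ w[v] = w[uv]`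
(with the value `0` outside the image). -/
def twistedProd {ξ : Mat3} (w : Usl3 →ₗ[ℂ] (orbit ξ → ℂ)) (f₁ f₂ : orbit ξ → ℂ) : orbit ξ → ℂ :=
  if h : (∃ u, w u = f₁) ∧ (∃ v, w v = f₂) then w (h.1.choose * h.2.choose) else 0

/-- `w[u] ⋆ w[v] = w[uv]` holds for all `u`, `v`: the twisted product is well defined. -/
def TwistedProdWellDefined {ξ : Mat3} (w : Usl3 →ₗ[ℂ] (orbit ξ → ℂ)) : Prop :=
  ∀ u v : Usl3, twistedProd w (w u) (w v) = w (u * v)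

/-- The commutator of the twisted product. -/
def twistedComm {ξ : Mat3} (w : Usl3 →ₗ[ℂ] (orbit ξ → ℂ)) (f₁ f₂ : orbit ξ → ℂ) : orbit ξ → ℂ :=
  twistedProd w f₁ f₂ - twistedProd w f₂ f₁

/-- A `ξ`-ray `(w^s)_s` is of Poisson type: for all `f₁, f₂ ∈ Poly(O_ξ)`,
`f₁ ⋆^s f₂ → f₁ f₂` and `s r(ξ) [f₁, f₂]_{⋆^s} → i {f₁, f₂}` uniformly on `O_ξ`. The bracket of
`f₁ = F₁|_{O_ξ}` and `f₂ = F₂|_{O_ξ}` is `{F₁, F₂}|_{O_ξ}`; the statement is made for all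
polynomials `F₁, F₂` that restrict to `f₁, f₂`. The first clause says that `f₁`, `f₂`
are in the domain of `⋆^s` for all large `s`. -/
def IsPoissonType (ξ : Mat3) (w : ℕ → Usl3 →ₗ[ℂ] (orbit ξ → ℂ)) : Prop :=
  (∀ f ∈ polyOrbit ξ, ∃ s₀ : ℕ, ∀ s ≥ s₀, f ∈ Set.range (w s)) ∧
  ∀ f₁ ∈ polyOrbit ξ, ∀ f₂ ∈ polyOrbit ξ,
    TendstoUniformly (fun s : ℕ => twistedProd (w s) f₁ f₂) (f₁ * f₂) Filter.atTop ∧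
    ∀ F₁ F₂ : PolySu3, restrict ξ F₁ = f₁ → restrict ξ F₂ = f₂ →
      TendstoUniformly (fun s : ℕ => ((s : ℝ) * integralRadius ξ) • twistedComm (w s) f₁ f₂)
        (Complex.I • restrict ξ (poissonBracket F₁ F₂)) Filter.atTop

end Quark

end

open scoped Matrix

noncomputable section

namespace Quark

attribute [local instance 100] LieRing.ofAssociativeRing

open scoped InnerProductSpace TensorProduct
open Filter

universe u

/-! ### One-parameter subgroups of `SU(3)` -/

section Exponential

/-! Write `ξ = i diag(d)`, `η = Ad_g ξ` and `c = s r(ξ)`, and let the symbol of an operator `A` at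
`g` be its expectation in the coherent vector `g v`, with `v` the highest weight vector. Everything
rests on three facts.

(a) `exists_symbol_drep_mul`: the symbol of `ρ(X) A` is `-i c tr(X η)` times the symbol of `A`, plus
a combination of the symbols of `[ρ(E_k), A]` with coefficients polynomial in `η` and independent of
`s`. Indeed the part of `X` that is raising with respect to `η` kills `g v`, and the adjoint of the
rest acts on `g v` by a scalar. Differentiating symbols along one-parameter groups shows that
commutation with `ρ(E_k)` acts on them as `-{x_k, ·}` (`HasSymbol.lie`). Hence symbols of `U(𝔰𝔩(3))`
are polynomials on the orbit, and the operators with zero symbol form a left ideal, which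
irreducibility forces to vanish (`eq_zero_of_hasSymbol_zero`). This makes the twisted product well
defined.

(b) Burnside's theorem: `ρ` is onto, so the image of `b^s` consists of the symbols of all operators.

(c) `exists_symbol_mul`: the representation of highest weight `ω₁ + ω₂` embeds isometrically and
equivariantly in the tensor product, by some `J` with `v₃ ↦ v₁ ⊗ v₂`. The compression `J* (A ⊗ B) J`
has the product symbol. So every polynomial is a symbol for large `s`, and the operator `J* (A ⊗ 1)
J` with the symbol of a fixed `A` has norm at most `‖A‖`, uniformly in `s`.

Let `Q(F)` be the operator with symbol `F`. As `Q(x_j) = ρ(E_j) / (i c)`, fact (a) gives `Q(x_j)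
Q(F) = Q(x_j F) + Q(G) / s` with `G` independent of `s`, and `c [Q(x_j), Q(F)] = i Q({x_j, F})`
exactly. Induction on `F` by the Leibniz rule, with the bounds from (c), yields both limits in
operator norm up to `O(1/s)`. Expectations in unit vectors are bounded by operator norms, so the
convergence is uniform on the orbit. -/

lemma det_exp_of_isHermitian {H : Mat3} (hH : H.IsHermitian) :
    (NormedSpace.exp (Complex.I • H)).det = Complex.exp (Complex.I * H.trace) := by
  have hsp := hH.spectral_theorem
  set U := hH.eigenvectorUnitary
  set D : Mat3 := Matrix.diagonal (RCLike.ofReal ∘ hH.eigenvalues) with hD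
  have hUU : (U : Mat3) * star (U : Mat3) = 1 := Unitary.mul_star_self_of_mem U.2
  have hUU' : star (U : Mat3) * (U : Mat3) = 1 := Unitary.star_mul_self_of_mem U.2
  have hinv : (U : Mat3)⁻¹ = star (U : Mat3) := Matrix.inv_eq_right_inv hUU
  have hH' : H = (U : Mat3) * D * (U : Mat3)⁻¹ := by
    rw [hinv]; exact hsp
  have hunit : IsUnit (U : Mat3) := ⟨⟨_, _, hUU, hUU'⟩, rfl⟩
  have h1 : Complex.I • H = (U : Mat3) * (Complex.I • D) * (U : Mat3)⁻¹ := by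
    conv_lhs => rw [hH']
    simp
  rw [h1, Matrix.exp_conj _ _ hunit, Matrix.det_conj hunit]
  have h2 : Complex.I • D = Matrix.diagonal
      (fun i => Complex.I * ((hH.eigenvalues i : ℝ) : ℂ)) := by
    rw [hD]; ext i j; by_cases h : i = j <;> simp [Matrix.diagonal, h]
  rw [h2, Matrix.exp_diagonal, Matrix.det_diagonal, hH.trace_eq_sum_eigenvalues, Finset.mul_sum,
    Complex.exp_sum]
  refine Finset.prod_congr rfl fun i _ => ?_
  rw [Pi.coe_exp, Complex.exp_eq_exp_ℂ]
  rfl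

open scoped Matrix.Norms.L2Operator in
lemma exists_isHermitian_exp {u : Mat3} (hu : u ∈ Matrix.unitaryGroup (Fin 3) ℂ) :
    ∃ H : Mat3, H.IsHermitian ∧ NormedSpace.exp (Complex.I • H) = u := by
  have hfin : (spectrum ℂ u).Finite := Matrix.finite_spectrum u
  have hnorm : IsStarNormal u :=
    ⟨(Unitary.star_mul_self_of_mem hu).trans (Unitary.mul_star_self_of_mem hu).symm⟩
  -- The spectrum is finite, so even the discontinuous `arg` is admissible in the functional
  -- calculus.
  have hc : ∀ f : ℂ → ℂ, ContinuousOn f (spectrum ℂ u) := fun f => hfin.continuousOn f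
  refine ⟨cfc (fun z : ℂ => ((z.arg : ℝ) : ℂ)) u, IsSelfAdjoint.cfc_arg u, ?_⟩
  have := hc (fun z : ℂ => ((z.arg : ℝ) : ℂ))
  rw [← CFC.exp_eq_normedSpace_exp (𝕜 := ℂ), ← cfc_comp_smul .., ← cfc_comp' ..]
  · conv_rhs => rw [← cfc_id' ℂ u]
    refine cfc_congr fun y hy => ?_
    have hy₁ : ‖y‖ = 1 := spectrum.norm_eq_one_of_unitary hu hy
    have hy0 : y ≠ 0 := by rintro rfl; simp at hy₁
    have : Complex.I * y.arg = Complex.log y :=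
      Complex.ext (by simp [Complex.log_re, hy₁]) (by simp [Complex.log_im])
    simpa [← Complex.exp_eq_exp_ℂ, this] using Complex.exp_log hy0

lemma isHermitian_of_conjTranspose_eq_neg {X : Mat3} (hX : Xᴴ = -X) :
    (-Complex.I • X).IsHermitian := by
  simp [Matrix.IsHermitian, Matrix.conjTranspose_smul, hX]

lemma exp_mem_specialUnitaryGroup {X : Mat3} (hX : Xᴴ = -X) (htr : X.trace = 0) :
    NormedSpace.exp X ∈ Matrix.specialUnitaryGroup (Fin 3) ℂ := by
  have hI : Complex.I • (-Complex.I • X) = X := by simp [smul_smul]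
  rw [Matrix.mem_specialUnitaryGroup_iff, Matrix.mem_unitaryGroup_iff]
  constructor
  · rw [Matrix.star_eq_conjTranspose, ← Matrix.exp_conjTranspose, hX, Matrix.exp_neg]
    exact Matrix.mul_nonsing_inv _ ((Matrix.isUnit_iff_isUnit_det _).1 (Matrix.isUnit_exp X))
  · rw [← hI, det_exp_of_isHermitian (isHermitian_of_conjTranspose_eq_neg hX)]
    simp [htr]

lemma sl3_trace (X : sl3) : (X : Mat3).trace = 0 :=
  LinearMap.mem_ker.1 X.2

/-- The one-parameter subgroup of `SU(3)` generated by `X ∈ 𝔰𝔲(3)`. -/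
def oneParam (X : sl3) (hX : (X : Mat3)ᴴ = -(X : Mat3)) (t : ℝ) : SU3 :=
  ⟨NormedSpace.exp (t • (X : Mat3)),
    exp_mem_specialUnitaryGroup (by simp [hX]) (by simp [sl3_trace])⟩

lemma coe_oneParam (X : sl3) (hX : (X : Mat3)ᴴ = -(X : Mat3)) (t : ℝ) :
    (oneParam X hX t : Mat3) = NormedSpace.exp (t • (X : Mat3)) := rfl

lemma oneParam_zero (X : sl3) (hX : (X : Mat3)ᴴ = -(X : Mat3)) : oneParam X hX 0 = 1 := by
  ext1; simp [coe_oneParam]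

lemma oneParam_add (X : sl3) (hX : (X : Mat3)ᴴ = -(X : Mat3)) (s t : ℝ) :
    oneParam X hX (s + t) = oneParam X hX s * oneParam X hX t := by
  ext1
  rw [Submonoid.coe_mul, coe_oneParam, coe_oneParam, coe_oneParam, add_smul]
  exact Matrix.exp_add_of_commute _ _ (((Commute.refl _).smul_left s).smul_right t)

/-- An element of `SU(3)` is a product of two elements of one-parameter subgroups. -/
lemma SU3_eq_oneParam_mul (g : SU3) : ∃ (X Y : sl3) (hX : (X : Mat3)ᴴ = -(X : Mat3))
    (hY : (Y : Mat3)ᴴ = -(Y : Mat3)), g = oneParam X hX 1 * oneParam Y hY 1 := by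
  obtain ⟨hgu, hgd⟩ := Matrix.mem_specialUnitaryGroup_iff.1 g.2
  obtain ⟨H, hH, hexp⟩ := exists_isHermitian_exp hgu
  have hdet := det_exp_of_isHermitian hH
  rw [hexp, hgd, eq_comm, Complex.exp_eq_one_iff] at hdet
  obtain ⟨n, hn⟩ := hdet
  have hI : Complex.I ≠ 0 := Complex.I_ne_zero
  have htr : H.trace = 2 * Real.pi * n := by
    apply mul_left_cancel₀ hI; rw [hn]; ring
  -- `H` need not be traceless. Subtracting `c • 1` makes it so, and the central factor `exp(i c)`
  -- is also the exponential of the traceless `Y`: the last entries `i c` and `-2 i c` differ by `3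
  -- i c = 2 π i n`.
  set c : ℂ := ((2 * Real.pi * n / 3 : ℝ) : ℂ) with hc
  have hcc : star c = c := Complex.conj_ofReal _
  let X : Mat3 := Complex.I • (H - c • (1 : Mat3))
  let Y : Mat3 := Matrix.diagonal ![Complex.I * c, Complex.I * c, -2 * (Complex.I * c)]
  have hYX : Complex.I • c • (1 : Mat3) = Matrix.diagonal (fun _ : Fin 3 => Complex.I * c) := by
    ext i j; by_cases h : i = j <;> simp [h]
  have hXtr : X.trace = 0 := by
    simp only [X, Matrix.trace_smul, Matrix.trace_sub, htr, Matrix.trace_one, hc]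
    simp
  have hYtr : Y.trace = 0 := by
    simp only [Y, Matrix.trace_diagonal, Fin.sum_univ_three]; simp; ring
  have hXs : Xᴴ = -X := by
    simp [X, Matrix.conjTranspose_smul, hH.eq, hcc]
  have hYs : Yᴴ = -Y := by
    rw [Matrix.diagonal_conjTranspose, Matrix.diagonal_neg]
    congr 1; ext i; fin_cases i <;> simp [hc]
  refine ⟨⟨X, by simpa [LieAlgebra.SpecialLinear.sl] using hXtr⟩,
    ⟨Y, by simpa [LieAlgebra.SpecialLinear.sl] using hYtr⟩, hXs, hYs, ?_⟩
  ext1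
  have hcenter : NormedSpace.exp Y = NormedSpace.exp (Complex.I • c • (1 : Mat3)) := by
    rw [hYX, Matrix.exp_diagonal, Matrix.exp_diagonal]
    congr 1; ext i
    rw [Pi.coe_exp, Pi.coe_exp, ← Complex.exp_eq_exp_ℂ]
    fin_cases i
    · simp
    · simp
    · simp only [Fin.reduceFinMk, Matrix.cons_val]
      rw [Complex.exp_eq_exp_iff_exists_int]
      refine ⟨-n, ?_⟩
      rw [hc]; push_cast; ring
  rw [Submonoid.coe_mul, coe_oneParam, coe_oneParam, one_smul, one_smul, hcenter]
  have hcomm : Commute X (Complex.I • c • (1 : Mat3)) :=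
    ((Commute.one_right X).smul_right c).smul_right Complex.I
  rw [← Matrix.exp_add_of_commute _ _ hcomm, ← hexp]
  congr 1
  simp [X, smul_sub]

end Exponential

/-! ### The orthonormal basis, diagonal weights and the integral radius -/

section GellMann

lemma gellMann_conjTranspose (j : Fin 8) : (gellMann j)ᴴ = gellMann j := by
  fin_cases j <;> ext a b <;> fin_cases a <;> fin_cases b <;>
    simp [gellMann, Matrix.conjTranspose_apply]

lemma E_conjTranspose (j : Fin 8) : (E j)ᴴ = -(E j) := by
  rw [E, Matrix.conjTranspose_smul, gellMann_conjTranspose, ← neg_smul]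
  congr 1
  simp [neg_div]

lemma E_trace (j : Fin 8) : (E j).trace = 0 := by
  fin_cases j <;> simp [E, gellMann, Matrix.trace, Fin.sum_univ_three]
  ring

/-- `E_j` as an element of `𝔰𝔩(3)`. -/
def Esl (j : Fin 8) : sl3 := ⟨E j, LinearMap.mem_ker.2 (E_trace j)⟩

lemma coord_eq (X : Mat3) (j : Fin 8) : coord X j = -(E j * X).trace := by
  simp [coord, E_conjTranspose]

lemma coord_smul_E (X : Mat3) (j : Fin 8) :
    coord X j • E j = ((gellMann j * X).trace / 2) • gellMann j := by
  have h2 : ((Real.sqrt 2 : ℝ) : ℂ) * ((Real.sqrt 2 : ℝ) : ℂ) = 2 := by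
    rw [← Complex.ofReal_mul, Real.mul_self_sqrt (by norm_num)]; simp
  have h20 : ((Real.sqrt 2 : ℝ) : ℂ) ≠ 0 := by
    intro h; rw [h] at h2; norm_num at h2
  rw [coord_eq, E, smul_smul]
  congr 1
  rw [Matrix.smul_mul, Matrix.trace_smul, smul_eq_mul]
  field_simp
  rw [Complex.I_sq, sq, h2]; ring

lemma eq_sum_coord_smul_E {X : Mat3} (hX : X.trace = 0) : X = ∑ k, coord X k • E k := by
  have h3 : ((Real.sqrt 3 : ℝ) : ℂ)⁻¹ * ((Real.sqrt 3 : ℝ) : ℂ)⁻¹ = 1 / 3 := by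
    rw [← mul_inv, ← Complex.ofReal_mul, Real.mul_self_sqrt (by norm_num)]; simp
  have hI := Complex.I_mul_I
  simp_rw [coord_smul_E]
  have hX2 : X 2 2 = -(X 0 0) - X 1 1 := by
    rw [Matrix.trace_fin_three] at hX; linear_combination hX
  set c : ℂ := ((Real.sqrt 3 : ℝ) : ℂ)⁻¹ with hc
  ext a b
  fin_cases a <;> fin_cases b <;>
    simp [Fin.sum_univ_eight, gellMann, Matrix.trace_fin_three, Matrix.mul_apply,
      Fin.sum_univ_three, hX2, ← hc]
  · linear_combination (-3/2 * (X 0 0 + X 1 1)) * h3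
  · linear_combination ((X 0 1 - X 1 0) / 2) * hI
  · linear_combination ((X 0 2 - X 2 0) / 2) * hI
  · linear_combination ((X 1 0 - X 0 1) / 2) * hI
  · linear_combination (-3/2 * (X 0 0 + X 1 1)) * h3
  · linear_combination ((X 1 2 - X 2 1) / 2) * hI
  · linear_combination ((X 2 0 - X 0 2) / 2) * hI
  · linear_combination ((X 2 1 - X 1 2) / 2) * hI
  · linear_combination (3 * (X 0 0 + X 1 1)) * h3

/-- The diagonal element `i diag(d)` of `𝔲(3)`. -/
def diagWeight (d : Fin 3 → ℝ) : Mat3 := Complex.I • Matrix.diagonal (fun i => (d i : ℂ))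

lemma smul_fundWeight_add (x y : ℝ) : x • fundWeight₁ + y • fundWeight₂ =
    diagWeight ![(2 * x + y) / 3, (y - x) / 3, -(x + 2 * y) / 3] := by
  have h2 : (Real.sqrt 2) * (Real.sqrt 2) = 2 := Real.mul_self_sqrt (by norm_num)
  have h3 : (Real.sqrt 3) * (Real.sqrt 3) = 3 := Real.mul_self_sqrt (by norm_num)
  have h6 : Real.sqrt 6 = Real.sqrt 2 * Real.sqrt 3 := by
    rw [← Real.sqrt_mul (by norm_num)]; norm_num
  have h23 : Real.sqrt (2 / 3) = Real.sqrt 2 / Real.sqrt 3 := Real.sqrt_div (by norm_num) _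
  have h20 : Real.sqrt 2 ≠ 0 := by positivity
  have h30 : Real.sqrt 3 ≠ 0 := by positivity
  have e (c : ℝ) (j : Fin 8) : c • E j = ((c / Real.sqrt 2 : ℝ) : ℂ) • Complex.I • gellMann j := by
    rw [E, ← Complex.coe_smul c, smul_smul, smul_smul]
    congr 1
    push_cast; ring
  have e2 : (1 / Real.sqrt 2 : ℝ) • E 2 = Complex.I • Matrix.diagonal ![1/2, -1/2, 0] := by
    rw [e, show 1 / Real.sqrt 2 / Real.sqrt 2 = 1 / 2 by rw [div_div, h2]]
    ext a b
    fin_cases a <;> fin_cases b <;> simp [gellMann] <;> ring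
  have e7 (c : ℝ) : c • E 7 =
      Complex.I • Matrix.diagonal
        (fun i => ((c / Real.sqrt 2 / Real.sqrt 3 * ![1, 1, -2] i : ℝ) : ℂ)) := by
    rw [e]
    ext a b
    fin_cases a <;> fin_cases b <;> simp [gellMann] <;> ring
  have h66 : 1 / Real.sqrt 6 / Real.sqrt 2 / Real.sqrt 3 = 1 / 6 := by
    rw [h6, div_div, div_div]; congr 1; linear_combination 3 * h2 + Real.sqrt 2 * Real.sqrt 2 * h3
  have h233 : Real.sqrt (2 / 3) / Real.sqrt 2 / Real.sqrt 3 = 1 / 3 := by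
    rw [h23]; field_simp; rw [sq, h3]
  rw [fundWeight₁, fundWeight₂, e2, e7, e7, h66, h233, diagWeight]
  ext a b
  fin_cases a <;> fin_cases b <;> simp <;> ring

lemma smul_diagWeight (c : ℝ) (d : Fin 3 → ℝ) : c • diagWeight d = diagWeight (c • d) := by
  ext a b
  by_cases h : a = b
  · subst h; simp [diagWeight]; ring
  · simp [diagWeight, h]

lemma diagWeight_injective : Function.Injective diagWeight := by
  intro d d' h
  ext i
  simpa [diagWeight] using congrFun (congrFun h i) i

lemma antitone_weightEntries {x y : ℝ} (hx : 0 ≤ x) (hy : 0 ≤ y) :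
    Antitone ![(2 * x + y) / 3, (y - x) / 3, -(x + 2 * y) / 3] := by
  rw [Fin.antitone_iff_succ_le]
  intro i; fin_cases i <;> simp <;> linarith

lemma Ad_eq (g : SU3) (X : Mat3) : Ad g X = (g : Mat3) * X * (g : Mat3)ᴴ := by
  rw [Ad, ← Matrix.star_eq_inv, Matrix.specialUnitaryGroup.coe_star,
    Matrix.star_eq_conjTranspose]

lemma SU3_conjTranspose_mul (g : SU3) : (g : Mat3)ᴴ * (g : Mat3) = 1 :=
  Matrix.mem_unitaryGroup_iff'.1 (Matrix.mem_specialUnitaryGroup_iff.1 g.2).1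

lemma SU3_mul_conjTranspose (g : SU3) : (g : Mat3) * (g : Mat3)ᴴ = 1 :=
  Matrix.mem_unitaryGroup_iff.1 (Matrix.mem_specialUnitaryGroup_iff.1 g.2).1

/-- Conjugation preserves the multiset of eigenvalues, and the ordering of the entries then recovers
them one by one: an orbit meets the closed Weyl chamber once. -/
lemma eq_of_Ad_diagWeight_eq {d d' : Fin 3 → ℝ} (hd : Antitone d) (hd' : Antitone d') {g : SU3}
    (h : Ad g (diagWeight d) = diagWeight d') : d = d' := by
  have h1 : (diagWeight d).charpoly = (diagWeight d').charpoly := by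
    rw [← h, Ad_eq, Matrix.charpoly_mul_comm, ← mul_assoc, SU3_conjTranspose_mul, one_mul]
  have hdiag (e : Fin 3 → ℝ) :
      diagWeight e = Matrix.diagonal (fun i => Complex.I * ((e i : ℝ) : ℂ)) := by
    ext a b
    by_cases h : a = b <;> simp [diagWeight, h]
  rw [hdiag, hdiag, Matrix.charpoly_diagonal, Matrix.charpoly_diagonal] at h1
  have hroots (f : Fin 3 → ℂ) :
      (∏ i, (Polynomial.X - Polynomial.C (f i))).roots = Finset.univ.val.map f := by
    rw [← Polynomial.roots_multiset_prod_X_sub_C (Finset.univ.val.map f), Multiset.map_map]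
    rfl
  have h2 := congrArg Polynomial.roots h1
  rw [hroots, hroots] at h2
  have h3 := congrArg (Multiset.map Complex.im) h2
  simp only [Multiset.map_map, Function.comp_def, Complex.I_mul_im, Complex.ofReal_re] at h3
  rw [Fin.univ_val_map, Fin.univ_val_map, Multiset.coe_eq_coe] at h3
  exact List.ofFn_injective (h3.eq_of_sortedGE hd.sortedGE_ofFn hd'.sortedGE_ofFn)

/-- This is the only place where rationality of the orbit enters. Discreteness of the weights keeps
the admissible radii away from `0`. -/
lemma integralRadius_pos {ξ : Mat3} (hξ : ξ ∈ rationalArc) : 0 < integralRadius ξ := by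
  obtain ⟨⟨x, y, hx, hy, hxy, rfl⟩, p, q, α, hα, hbij⟩ := hξ
  set c := Real.sqrt (3 / 2) with hc
  have hc0 : 0 < c := by positivity
  have hdom (p q : ℕ) : domWeight p q =
      diagWeight ![(2 * p + q) / 3, (q - p) / 3, -(p + 2 * q) / 3] := smul_fundWeight_add p q
  have hξd : c • (x • fundWeight₁ + y • fundWeight₂) =
      diagWeight ![(2 * (c * x) + c * y) / 3, (c * y - c * x) / 3, -(c * x + 2 * (c * y)) / 3] := by
    rw [← smul_fundWeight_add, smul_add, smul_smul, smul_smul]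
  set ξ := c • (x • fundWeight₁ + y • fundWeight₂) with hξ
  have hmem : domWeight p q ∈ orbit (domWeight p q) := ⟨1, by simp [Ad]⟩
  obtain ⟨g, hg⟩ := hbij.mapsTo hmem
  -- Nonemptiness is essential, since `sInf ∅ = 0`.
  have hne : (α⁻¹) ∈ {R : ℝ | 0 < R ∧ IsDominantWeight (R • ξ)} := by
    refine ⟨by positivity, p, q, ?_⟩
    have : ξ = α • domWeight p q := by
      have hg' : Ad g ξ = α • domWeight p q := hg
      rw [hdom, smul_diagWeight] at hg' ⊢
      rw [hξd] at hg' ⊢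
      rw [eq_of_Ad_diagWeight_eq (antitone_weightEntries (by positivity) (by positivity))
        ((antitone_weightEntries (by positivity) (by positivity)).const_smul hα.le) hg']
      rfl
    rw [this, smul_smul, inv_mul_cancel₀ hα.ne', one_smul]
  refine lt_of_lt_of_le (b := c⁻¹) (by positivity) (le_csInf ⟨_, hne⟩ ?_)
  rintro R ⟨hR, p', q', hpq⟩
  rw [hξd, hdom, smul_diagWeight] at hpq
  have hd := diagWeight_injective hpq
  have h0 : R * ((2 * (c * x) + c * y) / 3) = (2 * p' + q') / 3 := by simpa using congrFun hd 0
  have h1 : R * ((c * y - c * x) / 3) = (q' - p') / 3 := by simpa using congrFun hd 1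
  have hp : R * c * x = p' := by linear_combination h0 - h1
  have hq : R * c * y = q' := by linear_combination h0 + 2 * h1
  have hRc : 0 < R * c := by positivity
  have hx1 : x ≤ 1 := by nlinarith [mul_nonneg hx hy, sq_nonneg y]
  have hy1 : y ≤ 1 := by nlinarith [mul_nonneg hx hy, sq_nonneg x]
  suffices 1 ≤ R * c by
    rw [inv_eq_one_div, div_le_iff₀ hc0]; exact this
  -- If `R c < 1`, the natural numbers `R c x` and `R c y` are below `1` because `x, y ≤ 1`. So `x =
  -- y = 0`, against `x² + xy + y² = 1`.
  by_contra! hlt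
  have aux {z : ℝ} {n : ℕ} (hz0 : 0 ≤ z) (hz1 : z ≤ 1) (h : R * c * z = n) : z = 0 := by
    have hn : (n : ℝ) < 1 := by rw [← h]; nlinarith
    have hn0 : n = 0 := by exact_mod_cast Nat.lt_one_iff.1 (by exact_mod_cast hn)
    rw [hn0] at h
    simpa [hRc.ne'] using h
  rw [aux hx hx1 hp, aux hy hy1 hq] at hxy
  norm_num at hxy

end GellMann

/-! ### Uniqueness for skew-adjoint flows -/

section SkewFlow

variable {H : Type*} [NormedAddCommGroup H] [InnerProductSpace ℂ H]

/-- A skew flow conserves the norm. Applied to differences or projections of orbits, this passes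
from the Lie algebra to the group without exponentiating operators. -/
lemma eq_zero_of_hasDerivAt_skew {S : H → H} (hS : ∀ a, ⟪S a, a⟫_ℂ = -⟪a, S a⟫_ℂ) {w : ℝ → H}
    (hw : ∀ t, HasDerivAt w (S (w t)) t) (h0 : w 0 = 0) (t : ℝ) : w t = 0 := by
  have hd : ∀ t, HasDerivAt (fun t => ⟪w t, w t⟫_ℂ) 0 t := fun t => by
    have := (hw t).inner ℂ (hw t)
    rwa [hS, add_neg_cancel] at this
  have hc := is_const_of_deriv_eq_zero (fun t => (hd t).differentiableAt) (fun t => (hd t).deriv) t 0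
  simpa [h0] using hc

end SkewFlow

/-! ### Adjoint and conjugation on the Lie algebra -/

section Sl

/-- The conjugate transpose on `𝔰𝔩(3)`. -/
def adj (X : sl3) : sl3 := ⟨(X : Mat3)ᴴ, LinearMap.mem_ker.2 (by simp [sl3_trace])⟩

@[simp] lemma coe_adj (X : sl3) : (adj X : Mat3) = (X : Mat3)ᴴ := rfl

lemma exists_skew_decomposition (X : sl3) : ∃ A B : sl3, (A : Mat3)ᴴ = -(A : Mat3) ∧
    (B : Mat3)ᴴ = -(B : Mat3) ∧ X = A + Complex.I • B ∧ adj X = -A + Complex.I • B := by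
  refine ⟨(1 / 2 : ℂ) • (X - adj X), (-Complex.I / 2) • (X + adj X), ?_, ?_, ?_, ?_⟩
  · simp [Matrix.conjTranspose_smul, ← smul_neg]
  · simp [Matrix.conjTranspose_smul, add_comm, neg_div]
  · have : Complex.I * (-Complex.I / 2) = 1 / 2 := by linear_combination (-1/2) * Complex.I_mul_I
    rw [smul_smul, this]; module
  · have : Complex.I * (-Complex.I / 2) = 1 / 2 := by linear_combination (-1/2) * Complex.I_mul_I
    rw [smul_smul, this]; module

lemma trace_Ad (g : SU3) (X : Mat3) : (Ad g X).trace = X.trace := by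
  rw [Ad_eq, Matrix.trace_mul_comm, ← mul_assoc, SU3_conjTranspose_mul, one_mul]

lemma Ad_mul (g : SU3) (X Y : Mat3) : Ad g (X * Y) = Ad g X * Ad g Y := by
  simp only [Ad_eq]
  calc (g : Mat3) * (X * Y) * (g : Mat3)ᴴ = g * X * 1 * Y * (g : Mat3)ᴴ := by noncomm_ring
    _ = _ := by rw [← SU3_conjTranspose_mul g]; noncomm_ring

lemma Ad_sub (g : SU3) (X Y : Mat3) : Ad g (X - Y) = Ad g X - Ad g Y := by
  simp [Ad, mul_sub, sub_mul]

lemma Ad_add (g : SU3) (X Y : Mat3) : Ad g (X + Y) = Ad g X + Ad g Y := by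
  simp [Ad, mul_add, add_mul]

lemma Ad_smul (g : SU3) (c : ℂ) (X : Mat3) : Ad g (c • X) = c • Ad g X := by
  simp [Ad]

lemma Ad_mul_left (g h : SU3) (X : Mat3) : Ad (g * h) X = Ad g (Ad h X) := by
  simp [Ad, mul_assoc]

lemma Ad_one (X : Mat3) : Ad 1 X = X := by simp [Ad]

/-- The adjoint action of `SU(3)` on `𝔰𝔩(3)`. -/
def AdSl (g : SU3) : sl3 →ₗ[ℂ] sl3 where
  toFun X := ⟨Ad g X, LinearMap.mem_ker.2 (by
    rw [Matrix.traceLinearMap_apply, trace_Ad, sl3_trace])⟩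
  map_add' X Y := Subtype.ext (Ad_add g X Y)
  map_smul' c X := Subtype.ext (Ad_smul g c X)

@[simp] lemma coe_AdSl (g : SU3) (X : sl3) : (AdSl g X : Mat3) = Ad g X := rfl

lemma Ad_conjTranspose (g : SU3) (X : Mat3) : (Ad g X)ᴴ = Ad g Xᴴ := by
  simp [Ad_eq, mul_assoc]

lemma AdSl_skew {X : sl3} (g : SU3) (hX : (X : Mat3)ᴴ = -(X : Mat3)) :
    (AdSl g X : Mat3)ᴴ = -(AdSl g X : Mat3) := by
  rw [coe_AdSl, Ad_conjTranspose, hX]; simp [Ad]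

lemma oneParam_AdSl (g : SU3) (X : sl3) (hX : (X : Mat3)ᴴ = -(X : Mat3)) (t : ℝ) :
    oneParam (AdSl g X) (AdSl_skew g hX) t = g * oneParam X hX t * g⁻¹ := by
  have hinv : ((g⁻¹ : SU3) : Mat3) = (g : Mat3)⁻¹ := by
    rw [Matrix.inv_eq_right_inv (SU3_mul_conjTranspose g), ← Matrix.star_eq_inv,
      Matrix.specialUnitaryGroup.coe_star, Matrix.star_eq_conjTranspose]
  have hu : IsUnit (g : Mat3) := ⟨⟨_, _, SU3_mul_conjTranspose g, SU3_conjTranspose_mul g⟩, rfl⟩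
  ext1
  rw [Submonoid.coe_mul, Submonoid.coe_mul, coe_oneParam, coe_oneParam, hinv,
    ← Matrix.exp_conj _ _ hu, coe_AdSl, Ad, hinv]
  simp

end Sl

/-! ### From the group representation to the Lie algebra representation -/

namespace QuarkSystem

variable {ω : Mat3} (Q : QuarkSystem.{u} ω)

lemma rep_one_apply (a : Q.H) : Q.rep 1 a = a := by rw [map_one]; rfl

lemma rep_mul_apply (g h : SU3) (a : Q.H) : Q.rep (g * h) a = Q.rep g (Q.rep h a) := by
  rw [map_mul]; rfl

lemma rep_inv_rep (g : SU3) (a : Q.H) : Q.rep g⁻¹ (Q.rep g a) = a := by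
  rw [← rep_mul_apply, inv_mul_cancel, rep_one_apply]

lemma rep_rep_inv (g : SU3) (a : Q.H) : Q.rep g (Q.rep g⁻¹ a) = a := by
  rw [← rep_mul_apply, mul_inv_cancel, rep_one_apply]

lemma hasDerivAt_oneParam (X : sl3) (hX : (X : Mat3)ᴴ = -(X : Mat3)) (a : Q.H) (t : ℝ) :
    HasDerivAt (fun t : ℝ => Q.rep (oneParam X hX t) a)
      (Q.drep X (Q.rep (oneParam X hX t) a)) t := by
  have h := Q.hasDerivAt_rep X hX (oneParam X hX) (coe_oneParam X hX) (Q.rep (oneParam X hX t) a)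
  rw [show (0 : ℝ) = t - t by ring] at h
  have h' := h.comp_sub_const t t
  refine h'.congr_of_eventuallyEq (Filter.Eventually.of_forall fun s => ?_)
  show _ = Q.rep (oneParam X hX (s - t)) (Q.rep (oneParam X hX t) a)
  rw [← rep_mul_apply, ← oneParam_add, sub_add_cancel]

lemma inner_rep (g : SU3) (a b : Q.H) : ⟪Q.rep g a, Q.rep g b⟫_ℂ = ⟪a, b⟫_ℂ :=
  LinearIsometryEquiv.inner_map_map _ _ _

lemma hasDerivAt_oneParam_zero (X : sl3) (hX : (X : Mat3)ᴴ = -(X : Mat3)) (a : Q.H) :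
    HasDerivAt (fun t : ℝ => Q.rep (oneParam X hX t) a) (Q.drep X a) 0 := by
  simpa [oneParam_zero, rep_one_apply] using Q.hasDerivAt_oneParam X hX a 0

lemma inner_drep_of_skew (X : sl3) (hX : (X : Mat3)ᴴ = -(X : Mat3)) (a b : Q.H) :
    ⟪Q.drep X a, b⟫_ℂ = -⟪a, Q.drep X b⟫_ℂ := by
  have h := (Q.hasDerivAt_oneParam_zero X hX a).inner ℂ (Q.hasDerivAt_oneParam_zero X hX b)
  simp only [inner_rep, oneParam_zero, rep_one_apply] at h
  have := h.unique (hasDerivAt_const _ _)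
  linear_combination this

lemma inner_drep_adj (X : sl3) (a b : Q.H) : ⟪Q.drep (adj X) a, b⟫_ℂ = ⟪a, Q.drep X b⟫_ℂ := by
  obtain ⟨A, B, hA, hB, hX, hX'⟩ := exists_skew_decomposition X
  rw [hX', hX]
  simp only [map_add, map_neg, map_smul, LinearMap.add_apply, LinearMap.neg_apply,
    LinearMap.smul_apply, inner_add_left, inner_add_right, inner_neg_left, inner_smul_left,
    inner_smul_right, Q.inner_drep_of_skew A hA, Q.inner_drep_of_skew B hB, Complex.conj_I]
  ring

lemma rep_drep (g : SU3) (X : sl3) (a : Q.H) :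
    Q.rep g (Q.drep X a) = Q.drep (AdSl g X) (Q.rep g a) := by
  have key : ∀ Y : sl3, (Y : Mat3)ᴴ = -(Y : Mat3) → ∀ a,
      Q.rep g (Q.drep Y a) = Q.drep (AdSl g Y) (Q.rep g a) := by
    intro Y hY a
    have h1 := Q.hasDerivAt_oneParam_zero (AdSl g Y) (AdSl_skew g hY) (Q.rep g a)
    have h2 := ((Q.rep g).toContinuousLinearEquiv.toContinuousLinearMap.restrictScalars
      ℝ).hasFDerivAt.comp_hasDerivAt (0 : ℝ) (Q.hasDerivAt_oneParam_zero Y hY a)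
    refine h2.unique (h1.congr_of_eventuallyEq (Filter.Eventually.of_forall fun t => ?_))
    show Q.rep g (Q.rep (oneParam Y hY t) a) = Q.rep (oneParam (AdSl g Y) _ t) (Q.rep g a)
    rw [oneParam_AdSl, rep_mul_apply, rep_mul_apply, rep_inv_rep]
  obtain ⟨A, B, hA, hB, hX, -⟩ := exists_skew_decomposition X
  rw [hX]
  simp [key A hA, key B hB]

/-- The complement `Wᗮ` is invariant as well, so the projection onto it commutes with `drep`. The
projected curve `P (exp(tX) a)` then solves a skew linear equation with initial value `0`. Thus
irreducibility under the group gives irreducibility under the Lie algebra. -/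
lemma rep_mem_of_drep_mem {W : Submodule ℂ Q.H} (hW : ∀ X : sl3, ∀ a ∈ W, Q.drep X a ∈ W)
    (g : SU3) {a : Q.H} (ha : a ∈ W) : Q.rep g a ∈ W := by
  have hW' : ∀ X : sl3, ∀ a ∈ Wᗮ, Q.drep X a ∈ Wᗮ := by
    intro X a ha
    rw [Submodule.mem_orthogonal] at ha ⊢
    intro b hb
    rw [← inner_drep_adj]
    exact ha _ (hW _ _ hb)
  have key : ∀ (X : sl3) (hX : (X : Mat3)ᴴ = -(X : Mat3)), ∀ a ∈ W,
      Q.rep (oneParam X hX 1) a ∈ W := by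
    intro X hX a ha
    set P : Q.H →L[ℂ] Q.H := Wᗮ.starProjection with hP
    have hcomm : ∀ b, P (Q.drep X b) = Q.drep X (P b) := by
      intro b
      have hb : b = W.starProjection b + P b :=
        (W.starProjection_add_starProjection_orthogonal b).symm
      have h1 : P (Q.drep X (W.starProjection b)) = 0 := by
        rw [hP, Submodule.starProjection_apply_eq_zero_iff, Submodule.orthogonal_orthogonal]
        exact hW _ _ (W.starProjection_apply_mem b)
      have h2 : P (Q.drep X (P b)) = Q.drep X (P b) := by
        rw [hP, Submodule.starProjection_eq_self_iff]
        exact hW' _ _ (Wᗮ.starProjection_apply_mem b)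
      conv_lhs => rw [hb, map_add, map_add, h1, h2, zero_add]
    have hder : ∀ t, HasDerivAt (fun t : ℝ => P (Q.rep (oneParam X hX t) a))
        (Q.drep X (P (Q.rep (oneParam X hX t) a))) t := by
      intro t
      have := (P.restrictScalars ℝ).hasFDerivAt.comp_hasDerivAt t
        (Q.hasDerivAt_oneParam X hX a t)
      rw [← hcomm]
      exact this
    have h0 := eq_zero_of_hasDerivAt_skew (S := Q.drep X)
      (fun b => Q.inner_drep_of_skew X hX b b) hder (by
        simp only [oneParam_zero, rep_one_apply]
        rw [hP, Submodule.starProjection_apply_eq_zero_iff, Submodule.orthogonal_orthogonal]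
        exact ha) 1
    rwa [hP, Submodule.starProjection_apply_eq_zero_iff, Submodule.orthogonal_orthogonal] at h0
  obtain ⟨X, Y, hX, hY, rfl⟩ := SU3_eq_oneParam_mul g
  rw [rep_mul_apply]
  exact key X hX _ (key Y hY _ ha)

lemma eq_bot_or_eq_top_of_drep_mem {W : Submodule ℂ Q.H}
    (hW : ∀ X : sl3, ∀ a ∈ W, Q.drep X a ∈ W) : W = ⊥ ∨ W = ⊤ :=
  Q.irreducible W fun g _ ha => Q.rep_mem_of_drep_mem hW g ha

lemma univRep_ι (X : sl3) : Q.univRep (UniversalEnvelopingAlgebra.ι ℂ X) = Q.drep X :=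
  UniversalEnvelopingAlgebra.lift_ι_apply ℂ Q.drep X

/-- Every vector is cyclic. -/
lemma exists_univRep_apply_eq {a : Q.H} (ha : a ≠ 0) (b : Q.H) :
    ∃ x : Usl3, Q.univRep x a = b := by
  let W : Submodule ℂ Q.H := LinearMap.range ((LinearMap.applyₗ a).comp Q.univRep.toLinearMap)
  have hW : ∀ X : sl3, ∀ c ∈ W, Q.drep X c ∈ W := by
    rintro X _ ⟨x, rfl⟩
    exact ⟨UniversalEnvelopingAlgebra.ι ℂ X * x, by simp [← Q.univRep_ι]⟩
  rcases Q.eq_bot_or_eq_top_of_drep_mem hW with h | h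
  · have : a ∈ W := ⟨1, by simp⟩
    rw [h] at this
    exact absurd ((Submodule.mem_bot ℂ).1 this) ha
  · have : b ∈ W := by rw [h]; trivial
    exact this

end QuarkSystem

lemma trace_mul_neg_I_smul_diagWeight (X : Mat3) (d : Fin 3 → ℝ) :
    (X * (-Complex.I • diagWeight d)).trace = ∑ a, X a a * (d a : ℂ) := by
  have : -Complex.I • diagWeight d = Matrix.diagonal (fun i => (d i : ℂ)) := by
    simp [diagWeight, smul_smul]
  rw [this]
  simp [Matrix.trace]

/-! ### Induction on the enveloping algebra -/

section Enveloping

/-- Induction on the universal enveloping algebra by left multiplication with elements of the Lie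
algebra. -/
lemma Usl3_induction_left {p : Usl3 → Prop} (one : p 1)
    (add : ∀ x y, p x → p y → p (x + y)) (smul : ∀ (c : ℂ) x, p x → p (c • x))
    (mul : ∀ (X : sl3) x, p x → p (UniversalEnvelopingAlgebra.ι ℂ X * x)) (x : Usl3) : p x := by
  have key : ∀ t : TensorAlgebra ℂ sl3, ∀ y, p y →
      p (UniversalEnvelopingAlgebra.mkAlgHom ℂ sl3 t * y) := by
    intro t
    induction t using TensorAlgebra.induction with
    | algebraMap c => intro y hy; simpa [← Algebra.smul_def] using smul c y hy
    | ι X => intro y hy; simpa using mul X y hy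
    | mul a b ha hb => intro y hy; simpa [mul_assoc] using ha _ (hb y hy)
    | add a b ha hb => intro y hy; simpa [add_mul] using add _ _ (ha y hy) (hb y hy)
  obtain ⟨t, rfl⟩ : ∃ t, UniversalEnvelopingAlgebra.mkAlgHom ℂ sl3 t = x :=
    RingCon.mk'_surjective _ x
  simpa using key t 1 one

end Enveloping

/-! ### Projection onto the positive part as a polynomial in `ad η` -/

section PositivePart

/-- The operator `ad η` on matrices. -/
def adM (η X : Mat3) : Mat3 := η * X - X * η

lemma Ad_adM (g : SU3) (η X : Mat3) : Ad g (adM η X) = adM (Ad g η) (Ad g X) := by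
  simp [adM, Ad_sub, Ad_mul]

lemma trace_adM (η X : Mat3) : (adM η X).trace = 0 := by
  rw [adM, Matrix.trace_sub, Matrix.trace_mul_comm, sub_self]

lemma adM_iterate_diagWeight_apply (d : Fin 3 → ℝ) (X : Mat3) (n : ℕ) (a b : Fin 3) :
    ((adM (diagWeight d))^[n] X) a b = (Complex.I * (d a - d b)) ^ n * X a b := by
  induction n generalizing a b with
  | zero => simp
  | succ n ih =>
    rw [Function.iterate_succ_apply', adM, Matrix.sub_apply]
    simp only [diagWeight, Matrix.smul_mul, Matrix.mul_smul, Matrix.smul_apply, Matrix.diagonal_mul,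
      Matrix.mul_diagonal, smul_eq_mul]
    rw [show Complex.I • Matrix.diagonal (fun i => (d i : ℂ)) = diagWeight d from rfl, ih]
    ring

/-- The operator `p (ad η)` applied to `X`. -/
def polyAd (p : Polynomial ℂ) (η X : Mat3) : Mat3 :=
  ∑ n ∈ Finset.range (p.natDegree + 1), p.coeff n • (adM η)^[n] X

lemma polyAd_diagWeight_apply (p : Polynomial ℂ) (d : Fin 3 → ℝ) (X : Mat3) (a b : Fin 3) :
    polyAd p (diagWeight d) X a b = p.eval (Complex.I * (d a - d b)) * X a b := by
  rw [polyAd, Matrix.sum_apply, Polynomial.eval_eq_sum_range, Finset.sum_mul]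
  refine Finset.sum_congr rfl fun n _ => ?_
  rw [Matrix.smul_apply, adM_iterate_diagWeight_apply, smul_eq_mul, mul_assoc]

lemma Ad_polyAd (g : SU3) (p : Polynomial ℂ) (η X : Mat3) :
    Ad g (polyAd p η X) = polyAd p (Ad g η) (Ad g X) := by
  have hsum : ∀ (s : Finset ℕ) (f : ℕ → Mat3), Ad g (∑ n ∈ s, f n) = ∑ n ∈ s, Ad g (f n) := by
    intro s f
    simp [Ad, Finset.mul_sum, Finset.sum_mul]
  have hit : ∀ n, Ad g ((adM η)^[n] X) = (adM (Ad g η))^[n] (Ad g X) := by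
    intro n
    induction n with
    | zero => rfl
    | succ n ih => rw [Function.iterate_succ_apply', Function.iterate_succ_apply', Ad_adM, ih]
  simp [polyAd, hsum, Ad_smul, hit]

/-- The eigenvalues `i (d a - d b)` of `ad ξ` are finitely many, so Lagrange interpolation turns the
projection onto the positive eigenspaces into a polynomial `p (ad ξ)`. Such an expression is
equivariant under conjugation and therefore makes sense along the whole orbit. -/
lemma exists_positivePart_polynomial (d : Fin 3 → ℝ) : ∃ p : Polynomial ℂ, ∀ a b,
    p.eval (Complex.I * (d a - d b)) = if d b < d a then 1 else 0 := by
  classical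
  let S : Finset ℂ := Finset.univ.image fun ab : Fin 3 × Fin 3 => Complex.I * (d ab.1 - d ab.2)
  refine ⟨Lagrange.interpolate S id fun z => if 0 < z.im then 1 else 0, fun a b => ?_⟩
  have := Lagrange.eval_interpolate_at_node (s := S) (v := id) (i := Complex.I * (d a - d b))
    (fun z => if 0 < z.im then (1 : ℂ) else 0) (Function.injective_id.injOn)
    (Finset.mem_image.2 ⟨(a, b), Finset.mem_univ _, rfl⟩)
  rw [id] at this
  rw [this]
  simp

lemma coord_smul (c : ℂ) (X : Mat3) (k : Fin 8) : coord (c • X) k = c * coord X k := by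
  simp [coord]

lemma coord_sum {ι : Type*} (s : Finset ι) (f : ι → Mat3) (k : Fin 8) :
    coord (∑ i ∈ s, f i) k = ∑ i ∈ s, coord (f i) k := by
  simp [coord, Finset.mul_sum, Matrix.trace_sum]

lemma coord_adM_sum (η : Mat3) (hη : η.trace = 0) (c : Fin 8 → ℂ) (m : Fin 8) :
    coord (adM η (∑ k, c k • E k)) m = ∑ l, ∑ k, coord η l * c k * structConst l k m := by
  have : adM η (∑ k, c k • E k) =
      ∑ l, ∑ k, (coord η l * c k) • (E l * E k - E k * E l) := by
    conv_lhs => rw [eq_sum_coord_smul_E hη]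
    simp only [adM, Finset.sum_mul_sum, smul_mul_smul_comm, smul_sub, Finset.sum_sub_distrib]
    congr 1
    rw [Finset.sum_comm]
    simp_rw [mul_comm]
  rw [this, coord_sum]
  refine Finset.sum_congr rfl fun l _ => ?_
  rw [coord_sum]
  refine Finset.sum_congr rfl fun k _ => ?_
  rw [coord_smul, structConst]

lemma exists_poly_adM_iterate {X : Mat3} (hX : X.trace = 0) (n : ℕ) : ∃ t : Fin 8 → PolySu3,
    ∀ η : Mat3, η.trace = 0 →
      (adM η)^[n] X = ∑ k, MvPolynomial.eval (coord η) (t k) • E k := by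
  induction n with
  | zero => exact ⟨fun k => MvPolynomial.C (coord X k), fun η _ => by
      simpa using eq_sum_coord_smul_E hX⟩
  | succ n ih =>
    obtain ⟨t, ht⟩ := ih
    refine ⟨fun m => ∑ l, ∑ k, MvPolynomial.X l * t k * MvPolynomial.C (structConst l k m),
      fun η hη => ?_⟩
    rw [Function.iterate_succ_apply', ht η hη, eq_sum_coord_smul_E (trace_adM η _)]
    refine Finset.sum_congr rfl fun m _ => ?_
    rw [coord_adM_sum η hη]
    simp

/-- Since `ad η` is linear in `η`, the coefficients of `p (ad η) X` are polynomials in the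
coordinates of `η`. This is what keeps symbols polynomial on the orbit. -/
lemma exists_poly_polyAd {X : Mat3} (hX : X.trace = 0) (p : Polynomial ℂ) :
    ∃ t : Fin 8 → PolySu3, ∀ η : Mat3, η.trace = 0 →
      polyAd p η X = ∑ k, MvPolynomial.eval (coord η) (t k) • E k := by
  choose t ht using exists_poly_adM_iterate hX
  refine ⟨fun k => ∑ n ∈ Finset.range (p.natDegree + 1), MvPolynomial.C (p.coeff n) * t n k,
    fun η hη => ?_⟩
  simp only [polyAd, ht _ η hη, Finset.smul_sum, smul_smul, map_sum, map_mul, MvPolynomial.eval_C,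
    Finset.sum_smul]
  rw [Finset.sum_comm]

end PositivePart

/-! ### The parabolic subalgebra of the highest weight vector -/

namespace QuarkSystem

variable {ω : Mat3} (Q : QuarkSystem.{u} ω)

lemma drep_diag_hwVec {d : Fin 3 → ℝ} (hω : ω = diagWeight d) {X : sl3}
    (hX : (X : Mat3).IsDiag) :
    Q.drep X Q.hwVec = (∑ a, (X : Mat3) a a * (d a : ℂ)) • Q.hwVec := by
  subst hω
  rw [Q.drep_diag X hX, trace_mul_neg_I_smul_diagWeight]

open LieAlgebra.SpecialLinear in
-- With `X† v = 0`, the squared norm of `X v` is `⟨v, [X†, X] v⟩`, a multiple of `d b - d a = 0`.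
-- This handles singular weights, whose stabilizer is larger than the torus.
lemma drep_single_hwVec {d : Fin 3 → ℝ} (hω : ω = diagWeight d) {a b : Fin 3} (hba : b < a)
    (hd : d a = d b) (c : ℂ) : Q.drep (single a b hba.ne' c) Q.hwVec = 0 := by
  set X := single a b hba.ne' c with hX
  have hXc : (X : Mat3) = Matrix.single a b c := rfl
  have hup : Q.drep (adj X) Q.hwVec = 0 := by
    refine Q.drep_upper _ fun i j hij => ?_
    rw [coe_adj, hXc, Matrix.conjTranspose_apply, Matrix.single_apply, if_neg, star_zero]
    rintro ⟨rfl, rfl⟩; exact absurd hba (not_lt.2 hij)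
  have hdiag : Q.drep ⁅adj X, X⁆ Q.hwVec = 0 := by
    have hc : ((⁅adj X, X⁆ : sl3) : Mat3) =
        Matrix.diagonal (Pi.single b (star c * c) - Pi.single a (c * star c)) := by
      rw [sl_bracket, coe_adj, hXc, Matrix.conjTranspose_single, Matrix.single_mul_single_same,
        Matrix.single_mul_single_same, ← Matrix.diagonal_single, ← Matrix.diagonal_single,
        Matrix.diagonal_sub]
      rfl
    rw [Q.drep_diag_hwVec hω (by rw [hc]; exact Matrix.isDiag_diagonal _), hc]
    simp [Matrix.diagonal_apply_eq, sub_mul, Finset.sum_sub_distrib, Pi.single_apply, hd]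
    left; ring
  rw [LieHom.map_lie, LieRing.of_associative_ring_bracket, LinearMap.sub_apply,
    Module.End.mul_apply, Module.End.mul_apply, hup, map_zero, sub_zero] at hdiag
  rw [← inner_self_eq_zero (𝕜 := ℂ)]
  have := Q.inner_drep_adj (adj X) Q.hwVec (Q.drep X Q.hwVec)
  rw [hdiag, inner_zero_right] at this
  have hadj : adj (adj X) = X := Subtype.ext (by simp)
  rwa [hadj] at this

open LieAlgebra.SpecialLinear in
/-- The parabolic subalgebra attached to the highest weight acts on the highest weight vector by a
character. -/
lemma drep_parabolic {d : Fin 3 → ℝ} (hω : ω = diagWeight d) (hd : Antitone d) (X : sl3)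
    (hX : ∀ a b, d a < d b → (X : Mat3) a b = 0) :
    Q.drep X Q.hwVec = (∑ a, (X : Mat3) a a * (d a : ℂ)) • Q.hwVec := by
  have hlow : ∀ a b (h : b < a), Q.drep (single a b h.ne' ((X : Mat3) a b)) Q.hwVec = 0 := by
    intro a b h
    rcases (hd h.le).lt_or_eq with hlt | heq
    · rw [hX a b hlt, map_zero]; simp
    · exact Q.drep_single_hwVec hω h heq _
  let D : sl3 := ⟨Matrix.diagonal fun a => (X : Mat3) a a, LinearMap.mem_ker.2 (by
    simpa [Matrix.trace] using sl3_trace X)⟩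
  have hD : (D : Mat3) = Matrix.diagonal fun a => (X : Mat3) a a := rfl
  let Lw : sl3 := single 1 0 (by decide) ((X : Mat3) 1 0) + single 2 0 (by decide) ((X : Mat3) 2 0) +
    single 2 1 (by decide) ((X : Mat3) 2 1)
  have hLw : (Lw : Mat3) = Matrix.single 1 0 ((X : Mat3) 1 0) + Matrix.single 2 0 ((X : Mat3) 2 0) +
    Matrix.single 2 1 ((X : Mat3) 2 1) := rfl
  have hsplit : X = (X - D - Lw) + D + Lw := by abel
  have hU : Q.drep (X - D - Lw) Q.hwVec = 0 := by
    refine Q.drep_upper _ fun i j hij => ?_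
    have : ((X - D - Lw : sl3) : Mat3) = (X : Mat3) - (D : Mat3) - (Lw : Mat3) := rfl
    rw [this, hD, hLw]
    fin_cases i <;> fin_cases j <;> simp at hij <;> simp
  have hDv : Q.drep D Q.hwVec = (∑ a, (X : Mat3) a a * (d a : ℂ)) • Q.hwVec := by
    rw [Q.drep_diag_hwVec hω (by rw [hD]; exact Matrix.isDiag_diagonal _), hD]
    simp
  have hLv : Q.drep Lw Q.hwVec = 0 := by
    simp only [Lw, map_add, LinearMap.add_apply]
    rw [hlow 1 0 (by decide), hlow 2 0 (by decide), hlow 2 1 (by decide)]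
    simp
  rw [hsplit, map_add, map_add, LinearMap.add_apply, LinearMap.add_apply, hU, hDv, hLv]
  rw [← hsplit]; simp

end QuarkSystem

lemma Ad_inv_Ad (g : SU3) (X : Mat3) : Ad g⁻¹ (Ad g X) = X := by
  rw [← Ad_mul_left, inv_mul_cancel, Ad_one]

lemma Ad_Ad_inv (g : SU3) (X : Mat3) : Ad g (Ad g⁻¹ X) = X := by
  rw [← Ad_mul_left, mul_inv_cancel, Ad_one]

/-! ### Covariant symbols and the formula for left multiplication -/

namespace QuarkSystem

variable {ω : Mat3} (Q : QuarkSystem.{u} ω)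

/-- The covariant symbol of an operator, as a function on the group. -/
def symbol (g : SU3) : Module.End ℂ Q.H →ₗ[ℂ] ℂ where
  toFun A := ⟪Q.rep g Q.hwVec, A (Q.rep g Q.hwVec)⟫_ℂ
  map_add' A B := by simp
  map_smul' c A := by simp

lemma symbol_apply (g : SU3) (A : Module.End ℂ Q.H) :
    Q.symbol g A = ⟪Q.rep g Q.hwVec, A (Q.rep g Q.hwVec)⟫_ℂ := rfl

lemma norm_rep_hwVec (g : SU3) : ‖Q.rep g Q.hwVec‖ = 1 := by
  rw [LinearIsometryEquiv.norm_map, Q.norm_hwVec]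

lemma symbol_one (g : SU3) : Q.symbol g 1 = 1 := by
  rw [symbol_apply, Module.End.one_apply, inner_self_eq_norm_sq_to_K, norm_rep_hwVec]; simp

lemma trace_mul_hwProjAt (A : Module.End ℂ Q.H) (g : SU3) :
    LinearMap.trace ℂ Q.H (A * Q.hwProjAt g) = Q.symbol g A := by
  have h : A * Q.hwProjAt g =
      (InnerProductSpace.rankOne ℂ (A (Q.rep g Q.hwVec)) (Q.rep g Q.hwVec)).toLinearMap := by
    ext a
    have h1 : Q.hwProjAt g a =
        ⟪Q.hwVec, Q.rep g⁻¹ a⟫_ℂ • Q.rep g Q.hwVec := by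
      show Q.rep g ((ℂ ∙ Q.hwVec).starProjection (Q.rep g⁻¹ a)) = _
      rw [Submodule.starProjection_unit_singleton ℂ Q.norm_hwVec, map_smul]
    rw [Module.End.mul_apply, h1, map_smul, ← Q.inner_rep g, rep_rep_inv]
    simp
  rw [h, InnerProductSpace.trace_rankOne, symbol_apply]

/-- The positive part `Yp` kills `v`, so `Yp A v = [Yp, A] v`. The adjoint of `Y - Yp` lies in the
parabolic subalgebra and acts on `v` by the conjugate of the character. -/
lemma inner_hwVec_drep {d : Fin 3 → ℝ} (hω : ω = diagWeight d) (hd : Antitone d) {Y Yp : sl3}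
    (hYp : ∀ a b, (Yp : Mat3) a b = if d b < d a then (Y : Mat3) a b else 0)
    (A : Module.End ℂ Q.H) :
    ⟪Q.hwVec, Q.drep Y (A Q.hwVec)⟫_ℂ = (∑ a, (Y : Mat3) a a * (d a : ℂ)) *
      ⟪Q.hwVec, A Q.hwVec⟫_ℂ + ⟪Q.hwVec, ⁅Q.drep Yp, A⁆ Q.hwVec⟫_ℂ := by
  have hYn : ∀ a b, ((Y - Yp : sl3) : Mat3) a b = if d b < d a then 0 else (Y : Mat3) a b := by
    intro a b
    have : ((Y - Yp : sl3) : Mat3) a b = (Y : Mat3) a b - (Yp : Mat3) a b := rfl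
    rw [this, hYp]; split_ifs <;> simp
  have h1 : Q.drep (adj (Y - Yp)) Q.hwVec =
      (star (∑ a, (Y : Mat3) a a * (d a : ℂ))) • Q.hwVec := by
    rw [Q.drep_parabolic hω hd]
    · congr 1
      rw [star_sum]
      refine Finset.sum_congr rfl fun a _ => ?_
      rw [coe_adj, Matrix.conjTranspose_apply, hYn, if_neg (lt_irrefl _)]
      simp [mul_comm]
    · intro a b hab
      rw [coe_adj, Matrix.conjTranspose_apply, hYn, if_pos hab, star_zero]
  have h2 : Q.drep Yp Q.hwVec = 0 := by
    refine Q.drep_upper _ fun i j hij => ?_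
    rw [hYp, if_neg (not_lt.2 (hd hij))]
  have h3 := Q.inner_drep_adj (Y - Yp) Q.hwVec (A Q.hwVec)
  rw [h1, inner_smul_left, starRingEnd_apply, star_star, map_sub, LinearMap.sub_apply,
    inner_sub_right] at h3
  rw [LieRing.of_associative_ring_bracket, LinearMap.sub_apply, Module.End.mul_apply,
    Module.End.mul_apply, h2, map_zero, sub_zero]
  linear_combination -h3

end QuarkSystem

/-- Left multiplication by a Lie algebra element acts on symbols as a first order differential
operator on the orbit, with coefficients that do not depend on the representation. -/
lemma exists_symbol_drep_mul {d : Fin 3 → ℝ} (hd : Antitone d) (hd0 : (diagWeight d).trace = 0)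
    (X : sl3) : ∃ t : Fin 8 → PolySu3, ∀ {ω : Mat3} (Q : QuarkSystem.{u} ω) (c : ℝ), 0 < c →
      ω = diagWeight (c • d) → ∀ (A : Module.End ℂ Q.H) (g : SU3),
      Q.symbol g (Q.drep X * A) =
        -Complex.I * c * ((X : Mat3) * Ad g (diagWeight d)).trace * Q.symbol g A +
        ∑ k, MvPolynomial.eval (coord (Ad g (diagWeight d))) (t k) *
          Q.symbol g ⁅Q.drep (Esl k), A⁆ := by
  -- `p` and `t` are fixed from `d` and `X` before the representation is introduced. Rescaling `d`
  -- by `c > 0` does not change which differences are positive, so they serve the whole ray.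
  obtain ⟨p, hp⟩ := exists_positivePart_polynomial d
  obtain ⟨t, ht⟩ := exists_poly_polyAd (sl3_trace X) p
  refine ⟨t, fun {ω} Q c hc hω A g => ?_⟩
  set η := Ad g (diagWeight d) with hη
  have hηtr : η.trace = 0 := by rw [hη, trace_Ad, hd0]
  let Z : sl3 := ∑ k, MvPolynomial.eval (coord η) (t k) • Esl k
  have hZ : (Z : Mat3) = polyAd p η X := by
    rw [ht η hηtr]
    simp [Z, Esl]
  -- Conjugating by `g` reduces the formula at `g` to the one at the base point.
  let A' : Module.End ℂ Q.H := Q.op g⁻¹ * A * Q.op g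
  have hA' : ∀ a, A' a = Q.rep g⁻¹ (A (Q.rep g a)) := fun a => rfl
  have hYp : ∀ a b, (AdSl g⁻¹ Z : Mat3) a b =
      if (c • d) b < (c • d) a then (AdSl g⁻¹ X : Mat3) a b else 0 := by
    intro a b
    rw [coe_AdSl, hZ, Ad_polyAd, hη, Ad_inv_Ad, polyAd_diagWeight_apply, hp]
    simp only [Pi.smul_apply, smul_eq_mul, mul_lt_mul_iff_right₀ hc, coe_AdSl]
    split_ifs <;> simp
  have hcd : Antitone (c • d) := hd.const_smul hc.le
  have key := Q.inner_hwVec_drep hω hcd hYp A'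
  have hl : ∀ B : Module.End ℂ Q.H, ⟪Q.hwVec, Q.rep g⁻¹ (B (Q.rep g Q.hwVec))⟫_ℂ = Q.symbol g B := by
    intro B
    rw [← Q.inner_rep g, Q.rep_rep_inv, Q.symbol_apply]
  have e1 : ⟪Q.hwVec, Q.drep (AdSl g⁻¹ X) (A' Q.hwVec)⟫_ℂ = Q.symbol g (Q.drep X * A) := by
    rw [hA', ← Q.rep_drep, ← hl]; rfl
  have e2 : ⟪Q.hwVec, A' Q.hwVec⟫_ℂ = Q.symbol g A := by rw [hA', hl]
  have hZZ : AdSl g (AdSl g⁻¹ Z) = Z := Subtype.ext (Ad_Ad_inv g _)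
  have e3 : ⟪Q.hwVec, ⁅Q.drep (AdSl g⁻¹ Z), A'⁆ Q.hwVec⟫_ℂ = Q.symbol g ⁅Q.drep Z, A⁆ := by
    rw [← hl]
    congr 1
    simp only [LieRing.of_associative_ring_bracket, LinearMap.sub_apply, Module.End.mul_apply,
      map_sub, hA', ← Q.rep_drep]
    rw [Q.rep_drep g (AdSl g⁻¹ Z), hZZ]
  have e4 : ∑ a, (AdSl g⁻¹ X : Mat3) a a * (((c • d) a : ℝ) : ℂ) =
      -Complex.I * c * ((X : Mat3) * η).trace := by
    rw [← trace_mul_neg_I_smul_diagWeight, ← smul_diagWeight, ← Complex.coe_smul c, Matrix.mul_smul,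
      Matrix.mul_smul, Matrix.trace_smul, Matrix.trace_smul, smul_eq_mul, smul_eq_mul, ← mul_assoc]
    congr 1
    rw [← trace_Ad g, Ad_mul, coe_AdSl, Ad_Ad_inv]
  rw [e1, e2, e3, e4] at key
  rw [key]
  congr 1
  simp [Z, sum_lie]

/-! ### Derivatives along the orbit and the Poisson bracket -/

section Derivative

open scoped Matrix.Norms.L2Operator in
lemma hasDerivAt_exp_smul_apply (X : Mat3) (a b : Fin 3) :
    HasDerivAt (fun t : ℝ => NormedSpace.exp (t • X) a b) (X a b) 0 := by
  have h := hasDerivAt_exp_smul_const (𝕂 := ℝ) X (0 : ℝ)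
  simp only [zero_smul, NormedSpace.exp_zero, one_mul] at h
  let ev : Mat3 →ₗ[ℝ] ℂ := (Matrix.entryLinearMap ℝ ℂ a b)
  exact (LinearMap.toContinuousLinearMap ev).hasFDerivAt.comp_hasDerivAt (0 : ℝ) h

lemma hasDerivAt_coord_Ad_oneParam (X : sl3) (hX : (X : Mat3)ᴴ = -(X : Mat3)) (η : Mat3)
    (k : Fin 8) : HasDerivAt (fun t : ℝ => coord (Ad (oneParam X hX t) η) k)
      (coord (adM X η) k) 0 := by
  have h1 (a b : Fin 3) : HasDerivAt (fun t : ℝ => (oneParam X hX t : Mat3) a b) ((X : Mat3) a b) 0 :=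
    hasDerivAt_exp_smul_apply X a b
  have h2 (a b : Fin 3) : HasDerivAt (fun t : ℝ => (oneParam X hX t : Mat3)ᴴ a b)
      (-(X : Mat3) a b) 0 := by
    have := (h1 b a).star
    rwa [← Matrix.conjTranspose_apply, hX] at this
  have h3 (a b : Fin 3) : HasDerivAt (fun t : ℝ => Ad (oneParam X hX t) η a b)
      (adM X η a b) 0 := by
    simp only [Ad_eq, adM, Matrix.mul_apply, Matrix.sub_apply, Finset.sum_mul]
    have h5 : HasDerivAt (fun t : ℝ => ∑ j, ∑ i, (oneParam X hX t : Mat3) a i * η i j *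
        (oneParam X hX t : Mat3)ᴴ j b)
        (∑ j, ∑ i, ((X : Mat3) a i * η i j * (oneParam X hX 0 : Mat3)ᴴ j b +
          (oneParam X hX 0 : Mat3) a i * η i j * -(X : Mat3) j b)) 0 :=
      HasDerivAt.fun_sum fun j _ => HasDerivAt.fun_sum fun i _ =>
        ((h1 a i).mul_const _).mul (h2 j b)
    refine h5.congr_deriv ?_
    simp [oneParam_zero, Matrix.one_apply, Finset.sum_add_distrib, sub_eq_add_neg]
  simp only [coord, Matrix.trace, Matrix.diag, Matrix.mul_apply]
  exact HasDerivAt.fun_sum fun a _ => HasDerivAt.fun_sum fun b _ => (h3 b a).const_mul _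

lemma hasDerivAt_eval {x : ℝ → Fin 8 → ℂ} {x' : Fin 8 → ℂ} {t : ℝ}
    (hx : ∀ k, HasDerivAt (fun t => x t k) (x' k) t) (P : PolySu3) :
    HasDerivAt (fun t => MvPolynomial.eval (x t) P)
      (∑ k, MvPolynomial.eval (x t) (MvPolynomial.pderiv k P) * x' k) t := by
  induction P using MvPolynomial.induction_on with
  | C c => simpa using hasDerivAt_const t c
  | add P R hP hR =>
    simp only [map_add, add_mul, Finset.sum_add_distrib]
    exact hP.add hR
  | mul_X P j hP =>
    simp only [map_mul, MvPolynomial.eval_X]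
    refine (hP.fun_mul (hx j)).congr_deriv ?_
    symm
    simp only [Derivation.leibniz, MvPolynomial.pderiv_X, smul_eq_mul, map_add, map_mul,
      MvPolynomial.eval_X, add_mul, Finset.sum_add_distrib, Finset.sum_mul]
    rw [add_comm]
    congr 1
    · exact Finset.sum_congr rfl fun k _ => by ring
    · rw [Finset.sum_eq_single j]
      · simp
      · intro k _ hk; simp [hk.symm]
      · simp

lemma sum_coord_mul_coord (Z : Mat3) {η : Mat3} (hη : η.trace = 0) :
    ∑ l, coord Z l * coord η l = -(Z * η).trace := by
  conv_rhs => rw [eq_sum_coord_smul_E hη]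
  simp only [coord_eq Z, Finset.mul_sum, Matrix.mul_smul, Matrix.trace_sum, Matrix.trace_smul,
    smul_eq_mul, ← Finset.sum_neg_distrib]
  refine Finset.sum_congr rfl fun l _ => ?_
  rw [Matrix.trace_mul_comm]; ring

/-- The Hamiltonian vector field of `x_j` is `η ↦ [E_j, η]`, because the trace form is invariant. -/
lemma eval_poissonBracket_X (j : Fin 8) (P : PolySu3) {η : Mat3} (hη : η.trace = 0) :
    MvPolynomial.eval (coord η) (poissonBracket (MvPolynomial.X j) P) =
      ∑ k, MvPolynomial.eval (coord η) (MvPolynomial.pderiv k P) * coord (adM (E j) η) k := by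
  have h1 : ∀ k, coord (adM (E j) η) k = ∑ l, structConst k j l * coord η l := by
    intro k
    simp only [structConst]
    rw [sum_coord_mul_coord _ hη, coord_eq, adM]
    congr 1
    rw [mul_sub, sub_mul, Matrix.trace_sub, Matrix.trace_sub, ← mul_assoc, ← mul_assoc,
      Matrix.trace_mul_comm (E k * η), ← mul_assoc]
  simp only [poissonBracket, map_sum, map_mul, MvPolynomial.eval_C, MvPolynomial.eval_X]
  rw [Finset.sum_eq_single j]
  · refine Finset.sum_congr rfl fun k _ => ?_
    rw [h1, Finset.mul_sum]
    refine Finset.sum_congr rfl fun l _ => ?_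
    simp; ring
  · intro i _ hi
    simp [MvPolynomial.pderiv_X_of_ne hi.symm]
  · simp

end Derivative

/-! ### Polynomial symbols and injectivity of the symbol map -/

namespace QuarkSystem

variable {ω : Mat3} (Q : QuarkSystem.{u} ω)

/-- The operator `A` has the restriction of the polynomial `P` as its symbol on the orbit of `ξ`. -/
def HasSymbol (ξ : Mat3) (A : Module.End ℂ Q.H) (P : PolySu3) : Prop :=
  ∀ g : SU3, Q.symbol g A = MvPolynomial.eval (coord (Ad g ξ)) P

variable {Q}

/-- Both sides are, up to sign, the derivative at `0` of the symbol along `exp(t E_j) g`. On the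
Hilbert space it is computed by skewness, on the orbit by the chain rule. -/
lemma HasSymbol.lie {ξ : Mat3} (hξ : ξ.trace = 0) {A : Module.End ℂ Q.H} {P : PolySu3}
    (h : Q.HasSymbol ξ A P) (j : Fin 8) :
    Q.HasSymbol ξ ⁅Q.drep (Esl j), A⁆ (-poissonBracket (MvPolynomial.X j) P) := by
  intro g
  have hs : ((Esl j : sl3) : Mat3)ᴴ = -((Esl j : sl3) : Mat3) := E_conjTranspose j
  have h1 := Q.hasDerivAt_oneParam_zero (Esl j) hs (Q.rep g Q.hwVec)
  have h2 := h1.inner ℂ (((LinearMap.toContinuousLinearMap A).restrictScalars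
    ℝ).hasFDerivAt.comp_hasDerivAt (0 : ℝ) h1)
  have h3 := hasDerivAt_eval (t := (0 : ℝ))
    (fun k => hasDerivAt_coord_Ad_oneParam (Esl j) hs (Ad g ξ) k) P
  have h4 := h2.unique (h3.congr_of_eventuallyEq (Filter.Eventually.of_forall fun t => by
    show ⟪Q.rep (oneParam (Esl j) hs t) (Q.rep g Q.hwVec),
      A (Q.rep (oneParam (Esl j) hs t) (Q.rep g Q.hwVec))⟫_ℂ = _
    rw [← rep_mul_apply, ← symbol_apply, h, Ad_mul_left]))
  simp only [oneParam_zero, Ad_one] at h4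
  rw [map_neg, eval_poissonBracket_X j P (by rw [trace_Ad, hξ])]
  rw [show (E j) = ((Esl j : sl3) : Mat3) from rfl, ← h4]
  simp only [oneParam_zero, rep_one_apply, Function.comp_apply, ContinuousLinearMap.coe_restrictScalars',
    LinearMap.coe_toContinuousLinearMap', symbol_apply, LieRing.of_associative_ring_bracket,
    LinearMap.sub_apply, Module.End.mul_apply, inner_sub_right, Q.inner_drep_of_skew _ hs]
  ring

variable (Q)

lemma exists_hasSymbol {d : Fin 3 → ℝ} (hd : Antitone d) (hd0 : (diagWeight d).trace = 0)
    {c : ℝ} (hc : 0 < c) (hω : ω = diagWeight (c • d)) (x : Usl3) :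
    ∃ P : PolySu3, Q.HasSymbol (diagWeight d) (Q.univRep x) P := by
  induction x using Usl3_induction_left with
  | one => exact ⟨1, fun g => by simp [symbol_one]⟩
  | add x y hx hy =>
    obtain ⟨P, hP⟩ := hx
    obtain ⟨R, hR⟩ := hy
    exact ⟨P + R, fun g => by rw [map_add, map_add, map_add, hP, hR]⟩
  | smul a x hx =>
    obtain ⟨P, hP⟩ := hx
    exact ⟨a • P, fun g => by
      rw [map_smul, map_smul, hP, MvPolynomial.smul_eval, smul_eq_mul]⟩
  | mul X x hx =>
    obtain ⟨P, hP⟩ := hx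
    obtain ⟨t, ht⟩ := exists_symbol_drep_mul hd hd0 X
    refine ⟨MvPolynomial.C (Complex.I * c) *
        (∑ l, MvPolynomial.C (coord (X : Mat3) l) * MvPolynomial.X l) * P +
        ∑ k, t k * (-poissonBracket (MvPolynomial.X k) P), fun g => ?_⟩
    rw [map_mul, univRep_ι, ht Q c hc hω]
    have hl := fun k => (hP.lie hd0 k) g
    simp only [hl, hP g, map_add, map_mul, map_sum, MvPolynomial.eval_C, MvPolynomial.eval_X]
    rw [sum_coord_mul_coord _ (by rw [trace_Ad, hd0])]
    ring

/-- By the formula for left multiplication, a vanishing symbol persists under left multiplication by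
the enveloping algebra. -/
lemma eq_zero_of_hasSymbol_zero {d : Fin 3 → ℝ} (hd : Antitone d)
    (hd0 : (diagWeight d).trace = 0) {c : ℝ} (hc : 0 < c) (hω : ω = diagWeight (c • d))
    {A : Module.End ℂ Q.H} (hA : Q.HasSymbol (diagWeight d) A 0) : A = 0 := by
  have key : ∀ x : Usl3, Q.HasSymbol (diagWeight d) (Q.univRep x * A) 0 := by
    intro x
    induction x using Usl3_induction_left with
    | one => simpa using hA
    | add x y hx hy => exact fun g => by rw [map_add, add_mul, map_add, hx, hy]; simp
    | smul a x hx => exact fun g => by rw [map_smul, smul_mul_assoc, map_smul, hx]; simp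
    | mul X x hx =>
      obtain ⟨t, ht⟩ := exists_symbol_drep_mul hd hd0 X
      intro g
      have hl := fun k => (hx.lie hd0 k) g
      rw [map_mul Q.univRep, mul_assoc, univRep_ι, ht Q c hc hω]
      simp only [hl, hx g]
      simp [poissonBracket]
  -- Otherwise cyclicity gives `x` with `ρ(x) A g v = g v`, whose symbol at `g` is `1` instead of
  -- `0`.
  have hg : ∀ g, A (Q.rep g Q.hwVec) = 0 := by
    intro g
    by_contra hne
    obtain ⟨x, hx⟩ := Q.exists_univRep_apply_eq hne (Q.rep g Q.hwVec)
    have := key x g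
    rw [symbol_apply, Module.End.mul_apply, hx, inner_self_eq_norm_sq_to_K, norm_rep_hwVec] at this
    simp at this
  let W : Submodule ℂ Q.H := Submodule.span ℂ (Set.range fun g => Q.rep g Q.hwVec)
  have hW : W = ⊤ := by
    refine (Q.irreducible W fun g a ha => ?_).resolve_left fun hbot => ?_
    · induction ha using Submodule.span_induction with
      | mem a ha =>
        obtain ⟨h, rfl⟩ := ha
        exact Submodule.subset_span ⟨g * h, Q.rep_mul_apply g h _⟩
      | zero => simp
      | add a b _ _ ha hb => rw [map_add]; exact W.add_mem ha hb
      | smul a b _ hb => rw [map_smul]; exact W.smul_mem a hb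
    · have hmem : Q.hwVec ∈ W := Submodule.subset_span ⟨1, Q.rep_one_apply _⟩
      rw [hbot, Submodule.mem_bot] at hmem
      have := Q.norm_hwVec
      simp [hmem] at this
  have hker : W ≤ LinearMap.ker A := Submodule.span_le.2 (by rintro _ ⟨g, rfl⟩; exact hg g)
  exact LinearMap.ker_eq_top.1 (top_le_iff.1 (hW ▸ hker))

end QuarkSystem

/-! ### Surjectivity of the enveloping algebra representation -/

section Burnside

/-- **Burnside's theorem**: a subalgebra of operators that acts transitively on the nonzero vectors
of a finite-dimensional complex space is the full operator algebra. -/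
lemma subalgebra_eq_top_of_cyclic {V : Type*} [AddCommGroup V] [Module ℂ V]
    [FiniteDimensional ℂ V] [Nontrivial V] (S : Subalgebra ℂ (Module.End ℂ V))
    (hS : ∀ a : V, a ≠ 0 → ∀ b : V, ∃ A ∈ S, A a = b) : S = ⊤ := by
  have hsimple : IsSimpleModule S V := by
    refine isSimpleModule_iff_toSpanSingleton_surjective.2 ⟨inferInstance, fun a ha b => ?_⟩
    obtain ⟨A, hA, hAb⟩ := hS a ha b
    exact ⟨⟨A, hA⟩, hAb⟩
  rw [eq_top_iff]
  intro f _
  -- Schur's lemma: an eigenvector `w` of `e` is moved to every vector by `S`, which commutes with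
  -- `e`.
  have hscalar : ∀ e : Module.End S V, ∃ c : ℂ, ∀ a, e a = c • a := by
    intro e
    let e' : Module.End ℂ V := e.restrictScalars ℂ
    obtain ⟨c, hc⟩ := Module.End.exists_eigenvalue e'
    obtain ⟨w, hw⟩ := hc.exists_hasEigenvector
    refine ⟨c, fun a => ?_⟩
    obtain ⟨A, hA, rfl⟩ := hS w hw.2 a
    have h1 : e ((⟨A, hA⟩ : S) • w) = (⟨A, hA⟩ : S) • e w := map_smul _ _ _
    have h2 : e w = c • w := hw.apply_eq_smul
    rw [h2] at h1
    have h3 : e (A w) = A (c • w) := h1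
    rw [h3, map_smul]
  -- As the commutant is scalar, any linear `f` is linear over it. The density theorem then matches
  -- `f` with an element of `S` on a basis.
  let f' : Module.End (Module.End S V) V :=
    { toFun := f
      map_add' := map_add f
      map_smul' := fun e a => by
        obtain ⟨c, hc⟩ := hscalar e
        simp [hc] }
  let b := Module.finBasis ℂ V
  classical
  obtain ⟨r, hr⟩ := jacobson_density f' (Finset.univ.image b)
  have : f = (r : Module.End ℂ V) := b.ext fun i =>
    hr (b i) (Finset.mem_image.2 ⟨i, Finset.mem_univ _, rfl⟩)
  rw [this]
  exact r.2

lemma QuarkSystem.univRep_surjective {ω : Mat3} (Q : QuarkSystem.{u} ω) :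
    Function.Surjective Q.univRep := by
  have : Nontrivial Q.H := ⟨Q.hwVec, 0, by
    intro h; have := Q.norm_hwVec; simp [h] at this⟩
  rw [← AlgHom.range_eq_top]
  refine subalgebra_eq_top_of_cyclic _ fun a ha b => ?_
  obtain ⟨x, hx⟩ := Q.exists_univRep_apply_eq ha b
  exact ⟨_, ⟨x, rfl⟩, hx⟩

end Burnside

/-! ### Uniqueness of highest weight modules -/

section HighestWeightModules

variable {H : Type*} [NormedAddCommGroup H] [InnerProductSpace ℂ H]

/-- A star representation of `𝔰𝔩(3)` with a highest weight unit vector of weight `diag(d)`. -/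
structure IsHighestWeight (τ : sl3 →ₗ⁅ℂ⁆ Module.End ℂ H) (v : H) (d : Fin 3 → ℝ) : Prop where
  inner_adj : ∀ X a b, ⟪τ (adj X) a, b⟫_ℂ = ⟪a, τ X b⟫_ℂ
  inner_self : ⟪v, v⟫_ℂ = 1
  upper : ∀ X : sl3, (∀ i j : Fin 3, j ≤ i → (X : Mat3) i j = 0) → τ X v = 0
  diag : ∀ X : sl3, (X : Mat3).IsDiag → τ X v = (∑ a, (X : Mat3) a a * (d a : ℂ)) • v

lemma QuarkSystem.isHighestWeight {ω : Mat3} (Q : QuarkSystem.{u} ω) {d : Fin 3 → ℝ}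
    (hω : ω = diagWeight d) : IsHighestWeight Q.drep Q.hwVec d where
  inner_adj := Q.inner_drep_adj
  inner_self := by rw [inner_self_eq_norm_sq_to_K, Q.norm_hwVec]; simp
  upper := Q.drep_upper
  diag _ hX := Q.drep_diag_hwVec hω hX

open UniversalEnvelopingAlgebra in
-- The commutator acts as a derivation, replacing one factor at a time by a bracket. So it keeps the
-- word length, which permits the induction in `IsHighestWeight.inner_lift_eq`.
lemma lie_mem_range_ι_pow (X : sl3) {n : ℕ} {x : Usl3}
    (hx : x ∈ (LinearMap.range (ι ℂ : sl3 →ₗ⁅ℂ⁆ Usl3).toLinearMap) ^ n) :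
    ι ℂ X * x - x * ι ℂ X ∈ (LinearMap.range (ι ℂ : sl3 →ₗ⁅ℂ⁆ Usl3).toLinearMap) ^ n := by
  induction n generalizing x with
  | zero =>
    rw [pow_zero, Submodule.mem_one] at hx
    obtain ⟨c, rfl⟩ := hx
    rw [Algebra.commutes, sub_self]
    exact Submodule.zero_mem _
  | succ n ih =>
    rw [pow_succ'] at hx ⊢
    induction hx using Submodule.mul_induction_on' with
    | mem_mul_mem m hm x hx =>
      obtain ⟨Y, rfl⟩ := hm
      have h1 : ι ℂ X * (ι ℂ Y * x) - ι ℂ Y * x * ι ℂ X =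
          ι ℂ ⁅X, Y⁆ * x + ι ℂ Y * (ι ℂ X * x - x * ι ℂ X) := by
        rw [LieHom.map_lie, LieRing.of_associative_ring_bracket]; noncomm_ring
      have hι (Z : sl3) : ι ℂ Z ∈ LinearMap.range (ι ℂ : sl3 →ₗ⁅ℂ⁆ Usl3).toLinearMap := ⟨Z, rfl⟩
      have h2 := Submodule.add_mem _ (Submodule.mul_mem_mul (hι ⁅X, Y⁆) hx)
        (Submodule.mul_mem_mul (hι Y) (ih hx))
      rw [← h1] at h2
      exact h2
    | add x _ y _ hx hy =>
      have h1 : ι ℂ X * (x + y) - (x + y) * ι ℂ X =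
          (ι ℂ X * x - x * ι ℂ X) + (ι ℂ X * y - y * ι ℂ X) := by noncomm_ring
      rw [h1]
      exact Submodule.add_mem _ hx hy

variable {K : Type*} [NormedAddCommGroup K] [InnerProductSpace ℂ K]
  {τ : sl3 →ₗ⁅ℂ⁆ Module.End ℂ H} {v : H} {σ : sl3 →ₗ⁅ℂ⁆ Module.End ℂ K} {w : K} {d : Fin 3 → ℝ}

open UniversalEnvelopingAlgebra in
-- Split `X` into lower, diagonal and upper parts. The adjoint of the lower part kills `v`, the
-- diagonal part gives the character, and the upper part is traded for a commutator.
lemma IsHighestWeight.inner_lift_ι_mul (h : IsHighestWeight τ v d) {X U : sl3}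
    (hU : ∀ i j : Fin 3, (U : Mat3) i j = if i < j then (X : Mat3) i j else 0) (x : Usl3) :
    ⟪v, lift ℂ τ (ι ℂ X * x) v⟫_ℂ = (∑ a, (X : Mat3) a a * (d a : ℂ)) * ⟪v, lift ℂ τ x v⟫_ℂ +
      ⟪v, lift ℂ τ (ι ℂ U * x - x * ι ℂ U) v⟫_ℂ := by
  let D : sl3 := ⟨Matrix.diagonal fun a => (X : Mat3) a a, LinearMap.mem_ker.2 (by
    simpa [Matrix.trace] using sl3_trace X)⟩
  have hD : (D : Mat3) = Matrix.diagonal fun a => (X : Mat3) a a := rfl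
  have h1 : τ (adj (X - D - U)) v = 0 := by
    refine h.upper _ fun i j hij => ?_
    have : ((X - D - U : sl3) : Mat3) = (X : Mat3) - (D : Mat3) - (U : Mat3) := rfl
    rw [coe_adj, Matrix.conjTranspose_apply, this, Matrix.sub_apply, Matrix.sub_apply, hU, hD]
    rcases hij.lt_or_eq with hlt | rfl
    · simp [hlt, hlt.ne]
    · simp
  have h2 : τ (adj D) v = star (∑ a, (X : Mat3) a a * (d a : ℂ)) • v := by
    rw [h.diag]
    · simp [hD, star_sum, mul_comm]
    · rw [coe_adj, hD, Matrix.diagonal_conjTranspose]; exact Matrix.isDiag_diagonal _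
  have h3 : τ U v = 0 := h.upper _ fun i j hij => by rw [hU, if_neg (not_lt.2 hij)]
  have e1 := h.inner_adj (X - D - U) v (lift ℂ τ x v)
  have e2 := h.inner_adj D v (lift ℂ τ x v)
  rw [h1, inner_zero_left, map_sub, map_sub, LinearMap.sub_apply, LinearMap.sub_apply,
    inner_sub_right, inner_sub_right] at e1
  rw [h2, inner_smul_left, starRingEnd_apply, star_star] at e2
  simp only [map_mul, map_sub, lift_ι_apply, Module.End.mul_apply, LinearMap.sub_apply, h3,
    map_zero, sub_zero]
  linear_combination -e1 - e2

open UniversalEnvelopingAlgebra in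
/-- The vector state of a highest weight vector is determined by the weight. -/
lemma IsHighestWeight.inner_lift_eq (h : IsHighestWeight τ v d) (h' : IsHighestWeight σ w d)
    (x : Usl3) : ⟪v, lift ℂ τ x v⟫_ℂ = ⟪w, lift ℂ σ x w⟫_ℂ := by
  set V := LinearMap.range (ι ℂ : sl3 →ₗ⁅ℂ⁆ Usl3).toLinearMap with hV
  have key : ∀ n, ∀ x ∈ V ^ n, ⟪v, lift ℂ τ x v⟫_ℂ = ⟪w, lift ℂ σ x w⟫_ℂ := by
    intro n
    induction n with
    | zero =>
      intro x hx
      rw [pow_zero, Submodule.mem_one] at hx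
      obtain ⟨c, rfl⟩ := hx
      simp only [Algebra.algebraMap_eq_smul_one, map_smul, map_one, LinearMap.smul_apply,
        Module.End.one_apply, inner_smul_right, h.inner_self, h'.inner_self]
    | succ n ih =>
      intro x hx
      rw [pow_succ'] at hx
      induction hx using Submodule.mul_induction_on' with
      | mem_mul_mem m hm x hx =>
        obtain ⟨X, rfl⟩ := hm
        let U : sl3 := ⟨Matrix.of fun i j => if i < j then (X : Mat3) i j else 0,
          LinearMap.mem_ker.2 (by simp [Matrix.trace])⟩
        have hU : ∀ i j : Fin 3, (U : Mat3) i j = if i < j then (X : Mat3) i j else 0 :=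
          fun i j => rfl
        have e1 := h.inner_lift_ι_mul hU x
        have e2 := h'.inner_lift_ι_mul hU x
        -- Both `x` and its commutator with `U` have length `n`, one less than the product at hand.
        rw [ih x hx, ih _ (lie_mem_range_ι_pow U hx)] at e1
        exact e1.trans e2.symm
      | add x _ y _ hx hy => simp [hx, hy]
  have hx : x ∈ ⨆ n : ℕ, V ^ n := by
    induction x using Usl3_induction_left with
    | one => exact Submodule.mem_iSup_of_mem 0 (by rw [pow_zero]; exact Submodule.mem_one.2 ⟨1, map_one _⟩)
    | add x y hx hy => exact Submodule.add_mem _ hx hy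
    | smul c x hx => exact Submodule.smul_mem _ c hx
    | mul X x hx =>
      have h1 : ι ℂ X * x ∈ V * ⨆ n : ℕ, V ^ n := Submodule.mul_mem_mul ⟨X, rfl⟩ hx
      rw [Submodule.mul_iSup] at h1
      simp_rw [← pow_succ'] at h1
      exact iSup_le (fun n => le_iSup (fun n : ℕ => V ^ n) (n + 1)) h1
  induction hx using Submodule.iSup_induction' with
  | mem n x hx => exact key n x hx
  | zero => simp
  | add x y _ _ hx hy => simp [hx, hy]

open UniversalEnvelopingAlgebra in
-- Adjoints move the factors of `x` to the other side, which reduces the claim to the vector state.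
lemma IsHighestWeight.inner_lift_lift_eq (h : IsHighestWeight τ v d)
    (h' : IsHighestWeight σ w d) (x y : Usl3) :
    ⟪lift ℂ τ x v, lift ℂ τ y v⟫_ℂ = ⟪lift ℂ σ x w, lift ℂ σ y w⟫_ℂ := by
  induction x using Usl3_induction_left generalizing y with
  | one => simpa using h.inner_lift_eq h' y
  | add a b ha hb => simp [ha, hb]
  | smul c a ha => simp [ha]
  | mul X a ha =>
    have hadj : adj (adj X) = X := Subtype.ext (by simp)
    have e1 := h.inner_adj (adj X) (lift ℂ τ a v) (lift ℂ τ y v)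
    have e2 := h'.inner_adj (adj X) (lift ℂ σ a w) (lift ℂ σ y w)
    rw [hadj] at e1 e2
    have := ha (ι ℂ (adj X) * y)
    simp only [map_mul, lift_ι_apply, Module.End.mul_apply] at this ⊢
    rw [e1, e2, this]

open UniversalEnvelopingAlgebra in
/-- A cyclic highest weight representation embeds isometrically in any other one with the same
weight. -/
lemma IsHighestWeight.exists_isometry (h : IsHighestWeight τ v d) (h' : IsHighestWeight σ w d)
    (hcyc : ∀ a, ∃ x : Usl3, lift ℂ τ x v = a) :
    ∃ J : H →ₗᵢ[ℂ] K, J v = w ∧ ∀ X a, J (τ X a) = σ X (J a) := by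
  choose f hf using hcyc
  -- The chosen preimages `f a` do no harm: `(x - y) w` has the same norm as `(x - y) v`, which is
  -- `0`.
  have hd : ∀ x y : Usl3, lift ℂ τ x v = lift ℂ τ y v → lift ℂ σ x w = lift ℂ σ y w := by
    intro x y hxy
    rw [← sub_eq_zero, ← LinearMap.sub_apply, ← map_sub, ← inner_self_eq_zero (𝕜 := ℂ),
      ← h.inner_lift_lift_eq h', map_sub, LinearMap.sub_apply, hxy, sub_self, inner_zero_left]
  let J : H →ₗ[ℂ] K :=
    { toFun := fun a => lift ℂ σ (f a) w
      map_add' := fun a b => by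
        rw [← LinearMap.add_apply, ← map_add]
        exact hd _ _ (by rw [map_add, LinearMap.add_apply, hf, hf, hf])
      map_smul' := fun c a => by
        rw [RingHom.id_apply, ← LinearMap.smul_apply, ← map_smul]
        exact hd _ _ (by rw [map_smul, LinearMap.smul_apply, hf, hf]) }
  have hJ : ∀ x, J (lift ℂ τ x v) = lift ℂ σ x w := fun x => hd _ _ (hf _)
  refine ⟨J.isometryOfInner fun a b => ?_, ?_, fun X a => ?_⟩
  · show ⟪lift ℂ σ (f a) w, lift ℂ σ (f b) w⟫_ℂ = _
    rw [← h.inner_lift_lift_eq h', hf, hf]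
  · have := hJ 1
    simpa using this
  · obtain ⟨x, rfl⟩ : ∃ x, lift ℂ τ x v = a := ⟨f a, hf a⟩
    have := hJ (ι ℂ X * x)
    rw [map_mul, map_mul, lift_ι_apply, lift_ι_apply, Module.End.mul_apply, Module.End.mul_apply,
      ← hJ] at this
    exact this

end HighestWeightModules

/-! ### Tensor products and products of symbols -/

section Tensor

variable {H K : Type*} [NormedAddCommGroup H] [InnerProductSpace ℂ H]
  [NormedAddCommGroup K] [InnerProductSpace ℂ K]

/-- The tensor product of two representations of `𝔰𝔩(3)`. -/
def tensorRep (τ : sl3 →ₗ⁅ℂ⁆ Module.End ℂ H) (σ : sl3 →ₗ⁅ℂ⁆ Module.End ℂ K) :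
    sl3 →ₗ⁅ℂ⁆ Module.End ℂ (H ⊗[ℂ] K) where
  toFun X := TensorProduct.map (τ X) LinearMap.id + TensorProduct.map LinearMap.id (σ X)
  map_add' X Y := TensorProduct.ext' fun a b => by
    simp [TensorProduct.add_tmul, TensorProduct.tmul_add]; abel
  map_smul' c X := TensorProduct.ext' fun a b => by
    simp [TensorProduct.smul_tmul']
  map_lie' {X Y} := TensorProduct.ext' fun a b => by
    simp [LieRing.of_associative_ring_bracket, TensorProduct.sub_tmul, TensorProduct.tmul_sub]
    abel

variable {τ : sl3 →ₗ⁅ℂ⁆ Module.End ℂ H} {σ : sl3 →ₗ⁅ℂ⁆ Module.End ℂ K}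

lemma tensorRep_tmul (X : sl3) (a : H) (b : K) :
    tensorRep τ σ X (a ⊗ₜ b) = τ X a ⊗ₜ b + a ⊗ₜ σ X b := rfl

lemma IsHighestWeight.tensor {v : H} {w : K} {d e : Fin 3 → ℝ} (h : IsHighestWeight τ v d)
    (h' : IsHighestWeight σ w e) : IsHighestWeight (tensorRep τ σ) (v ⊗ₜ[ℂ] w) (d + e) where
  inner_adj X a b := by
    induction a using TensorProduct.induction_on with
    | zero => simp
    | add a a' ha ha' => rw [map_add, inner_add_left, inner_add_left, ha, ha']
    | tmul a a' =>
      induction b using TensorProduct.induction_on with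
      | zero => simp
      | add b b' hb hb' => rw [map_add, inner_add_right, inner_add_right, hb, hb']
      | tmul b b' =>
        simp only [tensorRep_tmul, inner_add_left, inner_add_right, TensorProduct.inner_tmul,
          h.inner_adj, h'.inner_adj]
  inner_self := by rw [TensorProduct.inner_tmul, h.inner_self, h'.inner_self, mul_one]
  upper X hX := by rw [tensorRep_tmul, h.upper X hX, h'.upper X hX]; simp
  diag X hX := by
    rw [tensorRep_tmul, h.diag X hX, h'.diag X hX, ← TensorProduct.smul_tmul',
      TensorProduct.tmul_smul, ← add_smul, ← Finset.sum_add_distrib]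
    congr 1
    exact Finset.sum_congr rfl fun a _ => by simp; ring

end Tensor

/-- The real structure underlying the complex normed space `H ⊗ K`; it takes precedence over the
real structure induced by the left factor. -/
@[reducible] def tensorRealModule {H K : Type*} [NormedAddCommGroup H]
    [InnerProductSpace ℂ H] [NormedAddCommGroup K] [InnerProductSpace ℂ K] : Module ℝ (H ⊗[ℂ] K) :=
  NormedSpace.complexToReal.toModule

attribute [local instance 2000] tensorRealModule

namespace QuarkSystem

variable {ω₁ ω₂ ω₃ : Mat3} (Q₁ : QuarkSystem.{u} ω₁) (Q₂ : QuarkSystem.{u} ω₂)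
  (Q₃ : QuarkSystem.{u} ω₃)

lemma hasDerivAt_map_oneParam (X : sl3) (hX : (X : Mat3)ᴴ = -(X : Mat3)) (z : Q₁.H ⊗[ℂ] Q₂.H)
    (t : ℝ) :
    HasDerivAt (fun t => TensorProduct.map (Q₁.op (oneParam X hX t)) (Q₂.op (oneParam X hX t)) z)
      (tensorRep Q₁.drep Q₂.drep X
        (TensorProduct.map (Q₁.op (oneParam X hX t)) (Q₂.op (oneParam X hX t)) z)) t := by
  induction z using TensorProduct.induction_on with
  | zero => simpa using hasDerivAt_const t (0 : Q₁.H ⊗[ℂ] Q₂.H)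
  | add a b ha hb =>
    simp only [map_add]
    exact ha.fun_add hb
  | tmul a b =>
    have h := ((TensorProduct.mkL ℂ Q₁.H Q₂.H).bilinearRestrictScalars ℝ).hasDerivAt_of_bilinear
      (fun _ => Q₁.hasDerivAt_oneParam X hX a t) (fun _ => Q₂.hasDerivAt_oneParam X hX b t)
    simp only [TensorProduct.map_tmul, tensorRep_tmul]
    rw [add_comm]
    exact h

variable {Q₁ Q₂ Q₃}

/-- Along a one-parameter group both sides solve the same skew equation with the same initial value,
and such elements generate `SU(3)`. -/
lemma isometry_rep {J : Q₃.H →ₗᵢ[ℂ] Q₁.H ⊗[ℂ] Q₂.H}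
    (hT : ∀ X a b, ⟪tensorRep Q₁.drep Q₂.drep (adj X) a, b⟫_ℂ =
      ⟪a, tensorRep Q₁.drep Q₂.drep X b⟫_ℂ)
    (hJ : ∀ X a, J (Q₃.drep X a) = tensorRep Q₁.drep Q₂.drep X (J a)) (g : SU3) (a : Q₃.H) :
    J (Q₃.rep g a) = TensorProduct.map (Q₁.op g) (Q₂.op g) (J a) := by
  have key : ∀ (X : sl3) (hX : (X : Mat3)ᴴ = -(X : Mat3)) (a : Q₃.H),
      J (Q₃.rep (oneParam X hX 1) a) =
        TensorProduct.map (Q₁.op (oneParam X hX 1)) (Q₂.op (oneParam X hX 1)) (J a) := by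
    intro X hX a
    have h1 : ∀ t, HasDerivAt (fun t => J (Q₃.rep (oneParam X hX t) a))
        (tensorRep Q₁.drep Q₂.drep X (J (Q₃.rep (oneParam X hX t) a))) t := by
      intro t
      rw [← hJ]
      exact (J.toContinuousLinearMap.restrictScalars ℝ).hasFDerivAt.comp_hasDerivAt t
        (Q₃.hasDerivAt_oneParam X hX a t)
    have h2 := fun t => (h1 t).sub (hasDerivAt_map_oneParam Q₁ Q₂ X hX (J a) t)
    simp only [← map_sub] at h2
    have hadj : adj X = -X := Subtype.ext hX
    have hskew : ∀ b, ⟪tensorRep Q₁.drep Q₂.drep X b, b⟫_ℂ =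
        -⟪b, tensorRep Q₁.drep Q₂.drep X b⟫_ℂ := by
      intro b
      rw [← hT, hadj, map_neg, LinearMap.neg_apply, inner_neg_left, neg_neg]
    have h3 := eq_zero_of_hasDerivAt_skew hskew h2 (by
      have e1 : Q₁.op 1 = LinearMap.id := LinearMap.ext fun b => Q₁.rep_one_apply b
      have e2 : Q₂.op 1 = LinearMap.id := LinearMap.ext fun b => Q₂.rep_one_apply b
      simp [oneParam_zero, e1, e2]) 1
    exact sub_eq_zero.1 h3
  obtain ⟨X, Y, hX, hY, rfl⟩ := SU3_eq_oneParam_mul g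
  have e1 : ∀ (ω : Mat3) (Q : QuarkSystem.{u} ω) (g h : SU3), Q.op (g * h) = Q.op g ∘ₗ Q.op h :=
    fun ω Q g h => LinearMap.ext fun b => Q.rep_mul_apply g h b
  rw [rep_mul_apply, key, key, e1, e1, TensorProduct.map_comp]
  rfl

variable (Q₁ Q₂ Q₃)

/-- If the highest weights add up, then products of symbols are symbols, and multiplication by the
symbol `1` does not increase operator bounds. -/
lemma exists_symbol_mul {d₁ d₂ d₃ : Fin 3 → ℝ} (h₁ : ω₁ = diagWeight d₁) (h₂ : ω₂ = diagWeight d₂)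
    (h₃ : ω₃ = diagWeight d₃) (hd : d₃ = d₁ + d₂) :
    ∃ Φ : Module.End ℂ Q₁.H → Module.End ℂ Q₂.H → Module.End ℂ Q₃.H,
      (∀ A B g, Q₃.symbol g (Φ A B) = Q₁.symbol g A * Q₂.symbol g B) ∧
      ∀ A (C : ℝ), 0 ≤ C → (∀ a, ‖A a‖ ≤ C * ‖a‖) → ∀ a, ‖Φ A 1 a‖ ≤ C * ‖a‖ := by
  have hw := (Q₁.isHighestWeight h₁).tensor (Q₂.isHighestWeight h₂)
  rw [← hd] at hw
  have hne : Q₃.hwVec ≠ 0 := by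
    intro h; have := Q₃.norm_hwVec; simp [h] at this
  obtain ⟨J, hJv, hJ⟩ := (Q₃.isHighestWeight h₃).exists_isometry hw
    (Q₃.exists_univRep_apply_eq hne)
  have : CompleteSpace Q₃.H := FiniteDimensional.complete ℂ _
  have : CompleteSpace (Q₁.H ⊗[ℂ] Q₂.H) := FiniteDimensional.complete ℂ _
  -- `Φ A B = J* (A ⊗ B) J`. Since `J (g v₃) = g v₁ ⊗ g v₂`, its expectation in `g v₃` factorizes.
  refine ⟨fun A B => (ContinuousLinearMap.adjoint J.toContinuousLinearMap).toLinearMap ∘ₗ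
    TensorProduct.map A B ∘ₗ J.toLinearMap, fun A B g => ?_, fun A C hC hA a => ?_⟩
  · rw [symbol_apply]
    have hg := isometry_rep hw.inner_adj hJ g Q₃.hwVec
    rw [hJv, TensorProduct.map_tmul] at hg
    show ⟪_, (ContinuousLinearMap.adjoint J.toContinuousLinearMap)
      (TensorProduct.map A B (J (Q₃.rep g Q₃.hwVec)))⟫_ℂ = _
    rw [ContinuousLinearMap.adjoint_inner_right]
    show ⟪J (Q₃.rep g Q₃.hwVec), _⟫_ℂ = _
    rw [hg, TensorProduct.map_tmul, TensorProduct.inner_tmul]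
    rfl
  · let A' : Q₁.H →L[ℂ] Q₁.H := LinearMap.toContinuousLinearMap A
    have hA' : ‖A'‖ ≤ C := ContinuousLinearMap.opNorm_le_bound _ hC hA
    have hadj : ‖ContinuousLinearMap.adjoint J.toContinuousLinearMap‖ ≤ 1 := by
      rw [LinearIsometryEquiv.norm_map]
      exact J.norm_toContinuousLinearMap_le
    calc ‖(ContinuousLinearMap.adjoint J.toContinuousLinearMap) (A'.rTensor Q₂.H (J a))‖
        ≤ 1 * ‖A'.rTensor Q₂.H (J a)‖ := ContinuousLinearMap.le_of_opNorm_le _ hadj _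
      _ ≤ C * ‖J a‖ := by
        rw [one_mul]
        exact ContinuousLinearMap.le_of_opNorm_le _ ((A'.norm_rTensor_le Q₂.H).trans hA') _
      _ = C * ‖a‖ := by rw [J.norm_map]

end QuarkSystem

/-! ### Families of operators that are bounded or of order `1 / s` -/

section Families

variable {H : ℕ → Type*} [∀ s, NormedAddCommGroup (H s)] [∀ s, InnerProductSpace ℂ (H s)]

/-- The family of operators `A` is eventually bounded. -/
def IsBdd (A : ∀ s, Module.End ℂ (H s)) : Prop :=
  ∃ C : ℝ, 0 ≤ C ∧ ∀ᶠ s in atTop, ∀ a, ‖A s a‖ ≤ C * ‖a‖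

/-- The family of operators `A` is of order `1 / s`. -/
def IsSmall (A : ∀ s, Module.End ℂ (H s)) : Prop :=
  ∃ C : ℝ, 0 ≤ C ∧ ∀ᶠ s : ℕ in atTop, ∀ a, ‖A s a‖ ≤ C / s * ‖a‖

variable {A B : ∀ s, Module.End ℂ (H s)}

lemma IsSmall.congr (hA : IsSmall A) (h : ∀ᶠ s in atTop, B s = A s) : IsSmall B := by
  obtain ⟨C, hC, hA⟩ := hA
  refine ⟨C, hC, ?_⟩
  filter_upwards [hA, h] with s hs h
  rwa [h]

lemma isSmall_zero : IsSmall (fun s => (0 : Module.End ℂ (H s))) :=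
  ⟨0, le_rfl, Eventually.of_forall fun s a => by simp⟩

lemma IsSmall.add (hA : IsSmall A) (hB : IsSmall B) : IsSmall (fun s => A s + B s) := by
  obtain ⟨C, hC, hA⟩ := hA
  obtain ⟨D, hD, hB⟩ := hB
  refine ⟨C + D, by positivity, ?_⟩
  filter_upwards [hA, hB] with s hA hB a
  rw [add_div, add_mul]
  exact (norm_add_le _ _).trans (add_le_add (hA a) (hB a))

lemma IsSmall.smul (hA : IsSmall A) (c : ℂ) : IsSmall (fun s => c • A s) := by
  obtain ⟨C, hC, hA⟩ := hA
  refine ⟨‖c‖ * C, by positivity, ?_⟩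
  filter_upwards [hA] with s hA a
  rw [LinearMap.smul_apply, norm_smul, mul_div_assoc, mul_assoc]
  exact mul_le_mul_of_nonneg_left (hA a) (norm_nonneg c)

lemma IsSmall.sub (hA : IsSmall A) (hB : IsSmall B) : IsSmall (fun s => A s - B s) := by
  simpa [sub_eq_add_neg] using hA.add (hB.smul (-1))

lemma IsBdd.mul_isSmall (hA : IsBdd A) (hB : IsSmall B) : IsSmall (fun s => A s * B s) := by
  obtain ⟨C, hC, hA⟩ := hA
  obtain ⟨D, hD, hB⟩ := hB
  refine ⟨C * D, by positivity, ?_⟩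
  filter_upwards [hA, hB] with s hA hB a
  rw [mul_div_assoc, mul_assoc]
  exact (hA _).trans (mul_le_mul_of_nonneg_left (hB a) hC)

lemma IsSmall.mul_isBdd (hA : IsSmall A) (hB : IsBdd B) : IsSmall (fun s => A s * B s) := by
  obtain ⟨C, hC, hA⟩ := hA
  obtain ⟨D, hD, hB⟩ := hB
  refine ⟨C * D, by positivity, ?_⟩
  filter_upwards [hA, hB] with s hA hB a
  calc ‖A s (B s a)‖ ≤ C / s * ‖B s a‖ := hA _
    _ ≤ C / s * (D * ‖a‖) := mul_le_mul_of_nonneg_left (hB a) (by positivity)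
    _ = C * D / s * ‖a‖ := by ring

lemma IsBdd.inv_smul (hA : IsBdd A) : IsSmall (fun s => (s : ℂ)⁻¹ • A s) := by
  obtain ⟨C, hC, hA⟩ := hA
  refine ⟨C, hC, ?_⟩
  filter_upwards [hA] with s hA a
  rw [LinearMap.smul_apply, norm_smul, norm_inv, Complex.norm_natCast, div_mul_eq_mul_div,
    div_eq_inv_mul]
  exact mul_le_mul_of_nonneg_left (hA a) (by positivity)

end Families

/-- The highest weights `ω s` run along the ray `s r i diag(d)`. -/
structure IsRay (ω : ℕ → Mat3) (r : ℝ) (d : Fin 3 → ℝ) : Prop where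
  antitone : Antitone d
  trace : (diagWeight d).trace = 0
  pos : 0 < r
  weight : ∀ s : ℕ, ω s = diagWeight (((s : ℝ) * r) • d)

/-! ### Quantization of polynomials along the ray -/

section Quantization

variable {ω : ℕ → Mat3} {r : ℝ} {d : Fin 3 → ℝ}
  (Q : ∀ s : ℕ, QuarkSystem.{u} (ω s))

lemma IsRay.scale_pos (hray : IsRay ω r d) {s : ℕ} (hs : 1 ≤ s) : 0 < (s : ℝ) * r :=
  mul_pos (by exact_mod_cast hs) hray.pos

variable {Q}

lemma IsRay.hasSymbol_unique (hray : IsRay ω r d) {s : ℕ} (hs : 1 ≤ s)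
    {A B : Module.End ℂ (Q s).H} {F : PolySu3}
    (hA : (Q s).HasSymbol (diagWeight d) A F) (hB : (Q s).HasSymbol (diagWeight d) B F) :
    A = B := by
  rw [← sub_eq_zero]
  refine (Q s).eq_zero_of_hasSymbol_zero hray.antitone hray.trace (hray.scale_pos hs)
    (hray.weight s) fun g => ?_
  rw [map_sub, hA, hB, sub_self, map_zero]

lemma IsRay.hasSymbol_X (hray : IsRay ω r d) {s : ℕ} (hs : 1 ≤ s) (j : Fin 8) :
    (Q s).HasSymbol (diagWeight d) ((Complex.I * ((s * r : ℝ) : ℂ))⁻¹ • (Q s).drep (Esl j))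
      (MvPolynomial.X j) := by
  obtain ⟨t, ht⟩ := exists_symbol_drep_mul.{u} hray.antitone hray.trace (Esl j)
  intro g
  have h := ht (Q s) _ (hray.scale_pos hs) (hray.weight s) 1 g
  simp only [LieRing.of_associative_ring_bracket, mul_one, one_mul, sub_self, map_zero, mul_zero,
    Finset.sum_const_zero, add_zero, (Q s).symbol_one] at h
  have h0 : ((s * r : ℝ) : ℂ) ≠ 0 := Complex.ofReal_ne_zero.2 (hray.scale_pos hs).ne'
  rw [map_smul, h, MvPolynomial.eval_X, coord_eq, smul_eq_mul]
  show _ * (-Complex.I * _ * (E j * _).trace) = _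
  field_simp

/-- Each coordinate `x_j` is a symbol at level `1`, and levels add when symbols are multiplied, so
multiplication by `x_j` costs one level. -/
lemma IsRay.exists_hasSymbol (hray : IsRay ω r d)
    (Q : ∀ s : ℕ, QuarkSystem.{u} (ω s)) (F : PolySu3) :
    ∃ k : ℕ, 1 ≤ k ∧ ∀ s ≥ k, ∃ A, (Q s).HasSymbol (diagWeight d) A F := by
  induction F using MvPolynomial.induction_on with
  | C c => exact ⟨1, le_rfl, fun s _ => ⟨c • 1, fun g => by
      rw [map_smul, (Q s).symbol_one]; simp⟩⟩
  | add F G hF hG =>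
    obtain ⟨k, hk, hF⟩ := hF
    obtain ⟨l, -, hG⟩ := hG
    refine ⟨max k l, hk.trans (le_max_left _ _), fun s hs => ?_⟩
    obtain ⟨A, hA⟩ := hF s ((le_max_left _ _).trans hs)
    obtain ⟨B, hB⟩ := hG s ((le_max_right _ _).trans hs)
    exact ⟨A + B, fun g => by rw [map_add, map_add, hA, hB]⟩
  | mul_X F j hF =>
    obtain ⟨k, hk, hF⟩ := hF
    refine ⟨k + 1, by omega, fun s hs => ?_⟩
    obtain ⟨n, rfl⟩ : ∃ n, s = n + 1 := ⟨s - 1, by omega⟩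
    obtain ⟨A, hA⟩ := hF n (by omega)
    have hX := hray.hasSymbol_X (Q := Q) le_rfl j
    obtain ⟨Φ, hΦ, -⟩ := (Q n).exists_symbol_mul (Q 1) (Q (n + 1)) (hray.weight n) (hray.weight 1)
      (hray.weight (n + 1)) (by rw [← add_smul]; push_cast; ring_nf)
    exact ⟨_, fun g => by rw [hΦ, hA, hX, map_mul]⟩

variable (Q) (d) in
open Classical in
/-- The operator on the space of `Q s` with symbol `F`, if there is one. -/
def quant (F : PolySu3) (s : ℕ) : Module.End ℂ (Q s).H :=
  if h : ∃ A, (Q s).HasSymbol (diagWeight d) A F then h.choose else 0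

variable (Q)

lemma IsRay.eventually_hasSymbol_quant (hray : IsRay ω r d) (F : PolySu3) :
    ∀ᶠ s in atTop, 1 ≤ s ∧ (Q s).HasSymbol (diagWeight d) (quant d Q F s) F := by
  obtain ⟨k, hk, h⟩ := hray.exists_hasSymbol Q F
  filter_upwards [eventually_ge_atTop k] with s hs
  refine ⟨hk.trans hs, ?_⟩
  rw [quant, dif_pos (h s hs)]
  exact (h s hs).choose_spec

/-- Fix an operator `A` with symbol `F` at level `k`. At level `k + n` the compression of `A ⊗ 1`
has symbol `F` too, hence equals the quantization, and its norm is at most `‖A‖`. -/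
lemma IsRay.isBdd_quant (hray : IsRay ω r d) (F : PolySu3) : IsBdd (quant d Q F) := by
  obtain ⟨k, hk, h⟩ := hray.exists_hasSymbol Q F
  obtain ⟨A, hA⟩ := h k le_rfl
  refine ⟨‖LinearMap.toContinuousLinearMap A‖, norm_nonneg _, ?_⟩
  filter_upwards [eventually_ge_atTop k, hray.eventually_hasSymbol_quant Q F] with s hs hF a
  obtain ⟨n, rfl⟩ : ∃ n, s = k + n := ⟨s - k, by omega⟩
  obtain ⟨Φ, hΦ, hb⟩ := (Q k).exists_symbol_mul (Q n) (Q (k + n)) (hray.weight k) (hray.weight n)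
      (hray.weight (k + n)) (by rw [← add_smul]; push_cast; ring_nf)
  have : quant d Q F (k + n) = Φ A 1 := hray.hasSymbol_unique hF.1 hF.2 fun g => by
    rw [hΦ, hA, (Q n).symbol_one, mul_one]
  rw [this]
  exact hb A _ (norm_nonneg _) (fun b => (LinearMap.toContinuousLinearMap A).le_opNorm b) a

lemma IsRay.quant_add (hray : IsRay ω r d) (F G : PolySu3) :
    ∀ᶠ s in atTop, quant d Q (F + G) s = quant d Q F s + quant d Q G s := by
  filter_upwards [hray.eventually_hasSymbol_quant Q F, hray.eventually_hasSymbol_quant Q G,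
    hray.eventually_hasSymbol_quant Q (F + G)] with s hF hG hFG
  exact hray.hasSymbol_unique hF.1 hFG.2 fun g => by rw [map_add, map_add, hF.2, hG.2]

lemma IsRay.quant_C_mul (hray : IsRay ω r d) (c : ℂ) (F : PolySu3) :
    ∀ᶠ s in atTop, quant d Q (MvPolynomial.C c * F) s = c • quant d Q F s := by
  filter_upwards [hray.eventually_hasSymbol_quant Q F,
    hray.eventually_hasSymbol_quant Q (MvPolynomial.C c * F)] with s hF hFG
  exact hray.hasSymbol_unique hF.1 hFG.2 fun g => by
    rw [map_smul, map_mul, hF.2, MvPolynomial.eval_C, smul_eq_mul]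

lemma IsRay.quant_C (hray : IsRay ω r d) (c : ℂ) :
    ∀ᶠ s in atTop, quant d Q (MvPolynomial.C c) s = c • 1 := by
  filter_upwards [hray.eventually_hasSymbol_quant Q (MvPolynomial.C c)] with s hF
  exact hray.hasSymbol_unique hF.1 hF.2 fun g => by
    rw [map_smul, (Q s).symbol_one, MvPolynomial.eval_C, smul_eq_mul, mul_one]

lemma IsRay.quant_X (hray : IsRay ω r d) (j : Fin 8) :
    ∀ᶠ s in atTop, quant d Q (MvPolynomial.X j) s =
    (Complex.I * ((s * r : ℝ) : ℂ))⁻¹ • (Q s).drep (Esl j) := by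
  filter_upwards [hray.eventually_hasSymbol_quant Q (MvPolynomial.X j)] with s hF
  exact hray.hasSymbol_unique hF.1 hF.2 (hray.hasSymbol_X hF.1 j)

lemma IsRay.quant_X_mul (hray : IsRay ω r d) (j : Fin 8) (F : PolySu3) :
    ∃ G : PolySu3, ∀ᶠ s in atTop,
    quant d Q (MvPolynomial.X j) s * quant d Q F s =
      quant d Q (MvPolynomial.X j * F) s + (s : ℂ)⁻¹ • quant d Q G s := by
  obtain ⟨t, ht⟩ := exists_symbol_drep_mul.{u} hray.antitone hray.trace (Esl j)
  -- Dividing the commutator terms by `i s r` leaves `1 / s` times a polynomial free of `s`; `(i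
  -- r)⁻¹` is what remains of the scale.
  let G : PolySu3 := MvPolynomial.C (Complex.I * (r : ℂ))⁻¹ *
    ∑ k, t k * (-poissonBracket (MvPolynomial.X k) F)
  refine ⟨G, ?_⟩
  filter_upwards [hray.eventually_hasSymbol_quant Q F, hray.quant_X Q j,
    hray.eventually_hasSymbol_quant Q (MvPolynomial.X j * F),
    hray.eventually_hasSymbol_quant Q G] with s hF hX hXF hG
  have hr0 : (r : ℂ) ≠ 0 := Complex.ofReal_ne_zero.2 hray.pos.ne'
  have hs0 : (s : ℂ) ≠ 0 := Nat.cast_ne_zero.2 (by omega)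
  refine hray.hasSymbol_unique hF.1
    (F := MvPolynomial.X j * F + MvPolynomial.C (s : ℂ)⁻¹ * G) (fun g => ?_) (fun g => ?_)
  · have hl := fun k => (hF.2.lie hray.trace k) g
    rw [hX, smul_mul_assoc, map_smul, ht (Q s) _ (hray.scale_pos hF.1) (hray.weight s)]
    simp only [hl, hF.2 g, G, map_add, map_mul, map_sum, MvPolynomial.eval_C, MvPolynomial.eval_X,
      coord_eq, smul_eq_mul]
    rw [show ((Esl j : sl3) : Mat3) = E j from rfl]
    push_cast
    field_simp
  · clear_value G
    rw [map_add, map_smul, hXF.2, hG.2, map_add, map_mul _ (MvPolynomial.C _),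
      MvPolynomial.eval_C, smul_eq_mul]

lemma IsRay.quant_X_comm (hray : IsRay ω r d) (j : Fin 8) (F : PolySu3) : ∀ᶠ s : ℕ in atTop,
    ((s * r : ℝ) : ℂ) • (quant d Q (MvPolynomial.X j) s * quant d Q F s -
      quant d Q F s * quant d Q (MvPolynomial.X j) s) =
      Complex.I • quant d Q (poissonBracket (MvPolynomial.X j) F) s := by
  filter_upwards [hray.eventually_hasSymbol_quant Q F, hray.quant_X Q j,
    hray.eventually_hasSymbol_quant Q (poissonBracket (MvPolynomial.X j) F)] with s hF hX hP
  have h0 : ((s * r : ℝ) : ℂ) ≠ 0 := Complex.ofReal_ne_zero.2 (hray.scale_pos hF.1).ne'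
  refine hray.hasSymbol_unique hF.1
    (F := MvPolynomial.C Complex.I * poissonBracket (MvPolynomial.X j) F) (fun g => ?_) (fun g => ?_)
  · have hl := (hF.2.lie hray.trace j) g
    rw [LieRing.of_associative_ring_bracket] at hl
    rw [hX, smul_mul_assoc, mul_smul_comm, ← smul_sub, map_smul, map_smul, hl, map_neg, map_mul,
      MvPolynomial.eval_C, smul_eq_mul, smul_eq_mul, mul_inv, Complex.inv_I]
    field_simp
  · rw [map_smul, hP.2, map_mul, MvPolynomial.eval_C, smul_eq_mul]

/-- The quantization is multiplicative up to order `1 / s`. -/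
lemma IsRay.isSmall_quant_mul (hray : IsRay ω r d) (F G : PolySu3) :
    IsSmall (fun s => quant d Q F s * quant d Q G s - quant d Q (F * G) s) := by
  induction F using MvPolynomial.induction_on generalizing G with
  | C c =>
    refine isSmall_zero.congr ?_
    filter_upwards [hray.quant_C Q c, hray.quant_C_mul Q c G] with s h1 h2
    rw [h1, h2, smul_mul_assoc, one_mul, sub_self]
  | add F F' hF hF' =>
    refine ((hF G).add (hF' G)).congr ?_
    filter_upwards [hray.quant_add Q F F', hray.quant_add Q (F * G) (F' * G)] with s h1 h2
    rw [add_mul F, h1, h2]; noncomm_ring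
  | mul_X F j hF =>
    obtain ⟨P, hP⟩ := hray.quant_X_mul Q j F
    obtain ⟨R, hR⟩ := hray.quant_X_mul Q j (F * G)
    -- With `Q(x F) = Q(x) Q(F) - Q(P)/s` and the analogous expression for `x F G`, the error is
    -- `Q(x) (Q(F) Q(G) - Q(F G)) + Q(R)/s - Q(P) Q(G)/s`.
    refine ((((hray.isBdd_quant Q (MvPolynomial.X j)).mul_isSmall (hF G)).add
      (hray.isBdd_quant Q R).inv_smul).sub
      ((hray.isBdd_quant Q P).inv_smul.mul_isBdd (hray.isBdd_quant Q G))).congr ?_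
    filter_upwards [hP, hR] with s hP hR
    rw [mul_comm F, mul_assoc, mul_sub, hR, ← mul_assoc (quant d Q (MvPolynomial.X j) s), hP]
    noncomm_ring

lemma IsRay.isSmall_quant_comm (hray : IsRay ω r d) (F G : PolySu3) :
    IsSmall (fun s => quant d Q F s * quant d Q G s - quant d Q G s * quant d Q F s) := by
  refine ((hray.isSmall_quant_mul Q F G).sub (hray.isSmall_quant_mul Q G F)).congr
    (Eventually.of_forall fun s => ?_)
  rw [mul_comm G F]; abel

lemma poissonBracket_add_left (F F' G : PolySu3) :
    poissonBracket (F + F') G = poissonBracket F G + poissonBracket F' G := by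
  simp only [poissonBracket, map_add, add_mul, mul_add, Finset.sum_add_distrib]

lemma poissonBracket_mul_left (F F' G : PolySu3) :
    poissonBracket (F * F') G = F * poissonBracket F' G + poissonBracket F G * F' := by
  simp only [poissonBracket, Derivation.leibniz, smul_eq_mul, Finset.mul_sum, Finset.sum_mul,
    ← Finset.sum_add_distrib]
  refine Finset.sum_congr rfl fun j _ => Finset.sum_congr rfl fun k _ =>
    Finset.sum_congr rfl fun l _ => ?_
  ring

lemma poissonBracket_C_left (c : ℂ) (G : PolySu3) : poissonBracket (MvPolynomial.C c) G = 0 := by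
  simp [poissonBracket]

/-- The rescaled commutator quantizes the Poisson bracket up to order `1 / s`. -/
lemma IsRay.isSmall_quant_lie (hray : IsRay ω r d) (F G : PolySu3) :
    IsSmall (fun s => ((s * r : ℝ) : ℂ) •
      (quant d Q F s * quant d Q G s - quant d Q G s * quant d Q F s) -
      Complex.I • quant d Q (poissonBracket F G) s) := by
  induction F using MvPolynomial.induction_on with
  | C c =>
    refine isSmall_zero.congr ?_
    filter_upwards [hray.quant_C Q c, hray.quant_C Q 0] with s h1 h2
    rw [poissonBracket_C_left, h1, ← map_zero MvPolynomial.C, h2]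
    simp
  | add F F' hF hF' =>
    refine (hF.add hF').congr ?_
    filter_upwards [hray.quant_add Q F F',
      hray.quant_add Q (poissonBracket F G) (poissonBracket F' G)] with s h1 h2
    rw [poissonBracket_add_left, h1, h2, add_mul, mul_add]
    module
  | mul_X F j hF =>
    obtain ⟨P, hP⟩ := hray.quant_X_mul Q j F
    have hX := hray.isBdd_quant Q (MvPolynomial.X j)
    -- Leibniz rule: `[Q(x F), Q(G)] = Q(x) [Q(F), Q(G)] + [Q(x), Q(G)] Q(F) - [Q(P), Q(G)]/s`. The
    -- first term uses the induction hypothesis and the second is exact. Products of quantizations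
    -- are then replaced by quantizations of products. After rescaling by `s r` the last term is `r
    -- [Q(P), Q(G)]`, still of order `1 / s`.
    refine ((((hX.mul_isSmall hF).add
      ((hray.isSmall_quant_mul Q (MvPolynomial.X j) (poissonBracket F G)).smul Complex.I)).add
      ((hray.isSmall_quant_mul Q (poissonBracket (MvPolynomial.X j) G) F).smul Complex.I)).sub
      ((hray.isSmall_quant_comm Q P G).smul r)).congr ?_
    filter_upwards [hP, hray.quant_X_comm Q j G, hray.quant_add Q
      (MvPolynomial.X j * poissonBracket F G) (poissonBracket (MvPolynomial.X j) G * F),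
      eventually_ge_atTop 1] with s hP hc hadd hs
    have hs0 : (s : ℂ) ≠ 0 := Nat.cast_ne_zero.2 (by omega)
    rw [mul_comm F, poissonBracket_mul_left, hadd, ← sub_eq_iff_eq_add.2 hP]
    have hc' := congrArg (· * quant d Q F s) hc
    simp only [smul_mul_assoc, sub_mul] at hc'
    have hr : (r : ℂ) = ((s * r : ℝ) : ℂ) * (s : ℂ)⁻¹ := by
      push_cast; field_simp
    rw [hr]
    generalize ((s * r : ℝ) : ℂ) = c at *
    simp only [smul_sub, sub_mul, mul_sub, mul_smul_comm, smul_mul_assoc, mul_assoc, ← smul_smul,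
      smul_add] at hc' ⊢
    rw [← hc']
    abel

end Quantization

/-! ### The Berezin correspondence, the twisted product and the limits -/

lemma exists_eq_diagWeight_of_mem_arc {ξ : Mat3} (hξ : ξ ∈ arc) :
    ∃ d : Fin 3 → ℝ, Antitone d ∧ (diagWeight d).trace = 0 ∧ ξ = diagWeight d := by
  obtain ⟨x, y, hx, hy, -, rfl⟩ := hξ
  rw [smul_fundWeight_add, smul_diagWeight]
  refine ⟨_, (antitone_weightEntries hx hy).const_smul (Real.sqrt_nonneg _), ?_, rfl⟩
  change (diagWeight (Real.sqrt (3 / 2) • ![(2 * x + y) / 3, (y - x) / 3, -(x + 2 * y) / 3])).trace = 0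
  rw [← smul_diagWeight, Matrix.trace_smul, diagWeight, Matrix.trace_smul, Matrix.trace_diagonal,
    ← Complex.ofReal_sum]
  have : ∑ i, ![(2 * x + y) / 3, (y - x) / 3, -(x + 2 * y) / 3] i = 0 := by
    rw [Fin.sum_univ_three]; simp; ring
  rw [this]
  simp

lemma orbitPt_surjective (ξ : Mat3) : Function.Surjective (orbitPt ξ) := by
  rintro ⟨_, g, rfl⟩
  exact ⟨g, rfl⟩

namespace QuarkSystem

variable {ω : Mat3} (Q : QuarkSystem.{u} ω) {ξ : Mat3}

/-- A polynomial symbol depends on `g` only through `Ad_g ξ`, so the choice of `g` over each point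
of the orbit is immaterial. -/
lemma univBerezin_eq_restrict {x : Usl3} {P : PolySu3} (h : Q.HasSymbol ξ (Q.univRep x) P) :
    Q.univBerezin ξ x = restrict ξ P := by
  funext X
  show LinearMap.trace ℂ Q.H (Q.univRep x * Q.hwProjAt X.2.choose) = _
  rw [trace_mul_hwProjAt, h, restrict]
  exact congrArg (fun Y => MvPolynomial.eval (coord Y) P) X.2.choose_spec

variable {d : Fin 3 → ℝ} {c : ℝ}

lemma univBerezin_orbitPt (hd : Antitone d) (hd0 : (diagWeight d).trace = 0) (hc : 0 < c)
    (hω : ω = diagWeight (c • d)) (x : Usl3) (g : SU3) :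
    Q.univBerezin (diagWeight d) x (orbitPt (diagWeight d) g) = Q.symbol g (Q.univRep x) := by
  obtain ⟨P, hP⟩ := Q.exists_hasSymbol hd hd0 hc hω x
  rw [Q.univBerezin_eq_restrict hP, hP g]
  rfl

lemma isBerezin_univBerezin (hd : Antitone d) (hd0 : (diagWeight d).trace = 0) (hc : 0 < c)
    (hω : ω = diagWeight (c • d)) :
    Q.IsBerezin (diagWeight d) (Q.univBerezin (diagWeight d)) := by
  intro x
  obtain ⟨P, hP⟩ := Q.exists_hasSymbol hd hd0 hc hω x
  refine ⟨⟨P, (Q.univBerezin_eq_restrict hP).symm⟩, fun g => ?_⟩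
  rw [trace_mul_hwProjAt, Q.univBerezin_orbitPt hd hd0 hc hω]

lemma univRep_eq_of_univBerezin_eq (hd : Antitone d) (hd0 : (diagWeight d).trace = 0) (hc : 0 < c)
    (hω : ω = diagWeight (c • d)) {x y : Usl3}
    (h : Q.univBerezin (diagWeight d) x = Q.univBerezin (diagWeight d) y) :
    Q.univRep x = Q.univRep y := by
  rw [← sub_eq_zero]
  refine Q.eq_zero_of_hasSymbol_zero hd hd0 hc hω fun g => ?_
  rw [map_sub, ← Q.univBerezin_orbitPt hd hd0 hc hω, ← Q.univBerezin_orbitPt hd hd0 hc hω, h,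
    sub_self, map_zero]

/-- The chosen preimages may differ from `x` and `y`, but injectivity of the symbol map gives them
the same images under `ρ`. -/
lemma twistedProdWellDefined_univBerezin (hd : Antitone d) (hd0 : (diagWeight d).trace = 0)
    (hc : 0 < c) (hω : ω = diagWeight (c • d)) :
    TwistedProdWellDefined (Q.univBerezin (diagWeight d)) := by
  intro x y
  have h : (∃ u, Q.univBerezin (diagWeight d) u = Q.univBerezin (diagWeight d) x) ∧
      (∃ v, Q.univBerezin (diagWeight d) v = Q.univBerezin (diagWeight d) y) := ⟨⟨x, rfl⟩, ⟨y, rfl⟩⟩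
  rw [twistedProd, dif_pos h]
  show Q.berezinSymbol (diagWeight d) (Q.univRep (h.1.choose * h.2.choose)) =
    Q.berezinSymbol (diagWeight d) (Q.univRep (x * y))
  rw [map_mul Q.univRep, map_mul Q.univRep, Q.univRep_eq_of_univBerezin_eq hd hd0 hc hω h.1.choose_spec,
    Q.univRep_eq_of_univBerezin_eq hd hd0 hc hω h.2.choose_spec]

lemma twistedProd_orbitPt (hd : Antitone d) (hd0 : (diagWeight d).trace = 0)
    (hc : 0 < c) (hω : ω = diagWeight (c • d)) {A B : Module.End ℂ Q.H} {F G : PolySu3}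
    (hA : Q.HasSymbol (diagWeight d) A F) (hB : Q.HasSymbol (diagWeight d) B G) (g : SU3) :
    twistedProd (Q.univBerezin (diagWeight d)) (restrict (diagWeight d) F)
      (restrict (diagWeight d) G) (orbitPt (diagWeight d) g) = Q.symbol g (A * B) := by
  obtain ⟨x, rfl⟩ := Q.univRep_surjective A
  obtain ⟨y, rfl⟩ := Q.univRep_surjective B
  rw [← Q.univBerezin_eq_restrict hA, ← Q.univBerezin_eq_restrict hB,
    Q.twistedProdWellDefined_univBerezin hd hd0 hc hω x y, Q.univBerezin_orbitPt hd hd0 hc hω,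
    map_mul]

lemma norm_symbol_le {A : Module.End ℂ Q.H} {C : ℝ} (hA : ∀ a, ‖A a‖ ≤ C * ‖a‖) (g : SU3) :
    ‖Q.symbol g A‖ ≤ C := by
  rw [symbol_apply]
  refine (norm_inner_le_norm _ _).trans ?_
  have := hA (Q.rep g Q.hwVec)
  rw [norm_rep_hwVec, mul_one] at this
  rwa [norm_rep_hwVec, one_mul]

end QuarkSystem

lemma tendstoUniformly_of_isSmall {ω : ℕ → Mat3} {Q : ∀ s : ℕ, QuarkSystem.{u} (ω s)} {ξ : Mat3}
    {S : ∀ s, Module.End ℂ (Q s).H} (hS : IsSmall S) {φ : ℕ → orbit ξ → ℂ} {f : orbit ξ → ℂ}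
    (h : ∀ᶠ s in atTop, ∀ g, φ s (orbitPt ξ g) - f (orbitPt ξ g) = (Q s).symbol g (S s)) :
    TendstoUniformly φ f atTop := by
  obtain ⟨C, hC, hS⟩ := hS
  rw [Metric.tendstoUniformly_iff]
  intro ε hε
  have hlim : Tendsto (fun s : ℕ => C / s) atTop (nhds 0) := tendsto_const_div_atTop_nhds_zero_nat C
  filter_upwards [hS, h, hlim.eventually (gt_mem_nhds hε)] with s hS h hlt X
  obtain ⟨g, rfl⟩ := orbitPt_surjective ξ X
  rw [dist_comm, dist_eq_norm, h g]
  exact ((Q s).norm_symbol_le hS g).trans_lt hlt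

lemma IsRay.isPoissonType {ω : ℕ → Mat3} {r : ℝ} {d : Fin 3 → ℝ} (hray : IsRay ω r d)
    (hr : r = integralRadius (diagWeight d)) (Q : ∀ s : ℕ, QuarkSystem.{u} (ω s)) :
    IsPoissonType (diagWeight d) (fun s => (Q s).univBerezin (diagWeight d)) := by
  have hprod (F G : PolySu3) : ∀ᶠ s in atTop, ∀ g,
      twistedProd ((Q s).univBerezin (diagWeight d)) (restrict (diagWeight d) F)
        (restrict (diagWeight d) G) (orbitPt (diagWeight d) g) =
      (Q s).symbol g (quant d Q F s * quant d Q G s) := by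
    filter_upwards [hray.eventually_hasSymbol_quant Q F, hray.eventually_hasSymbol_quant Q G]
      with s hF hG g
    exact (Q s).twistedProd_orbitPt hray.antitone hray.trace (hray.scale_pos hF.1) (hray.weight s)
      hF.2 hG.2 g
  refine ⟨?_, ?_⟩
  · rintro _ ⟨F, rfl⟩
    obtain ⟨k, -, h⟩ := hray.exists_hasSymbol Q F
    refine ⟨k, fun s hs => ?_⟩
    obtain ⟨A, hA⟩ := h s hs
    obtain ⟨x, rfl⟩ := (Q s).univRep_surjective A
    exact ⟨x, (Q s).univBerezin_eq_restrict hA⟩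
  · rintro f₁ ⟨F, rfl⟩ f₂ ⟨G, rfl⟩
    refine ⟨tendstoUniformly_of_isSmall (hray.isSmall_quant_mul Q F G) ?_, ?_⟩
    · filter_upwards [hprod F G, hray.eventually_hasSymbol_quant Q (F * G)] with s h hFG g
      rw [h g, map_sub, hFG.2 g, map_mul (MvPolynomial.eval _)]
      rfl
    -- The given lifts `F₁`, `F₂` are quantized directly, so independence of the bracket from the
    -- lifts is not needed beforehand.
    · intro F₁ F₂ h₁ h₂
      rw [← h₁, ← h₂]
      refine tendstoUniformly_of_isSmall (hray.isSmall_quant_lie Q F₁ F₂) ?_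
      filter_upwards [hprod F₁ F₂, hprod F₂ F₁,
        hray.eventually_hasSymbol_quant Q (poissonBracket F₁ F₂)] with s h h' hP g
      rw [map_sub, map_smul, map_smul, map_sub, hP.2 g, ← h g, ← h' g, hr, smul_eq_mul,
        ← Complex.real_smul]
      rfl

end Quark

end

theorem theorem3p6 (ξ : Quark.Mat3) (hξ : ξ ∈ Quark.rationalArc)
    (Q : ∀ s : ℕ, Quark.QuarkSystem ((s : ℝ) • Quark.firstWeight ξ)) :
    (∀ s : ℕ, 1 ≤ s → (Q s).IsBerezin ξ ((Q s).univBerezin ξ) ∧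
      Quark.TwistedProdWellDefined ((Q s).univBerezin ξ)) ∧
    Quark.IsPoissonType ξ (fun s => (Q s).univBerezin ξ) := by
  obtain ⟨d, hd, hd0, rfl⟩ := Quark.exists_eq_diagWeight_of_mem_arc hξ.1
  have hray : Quark.IsRay (fun s : ℕ => (s : ℝ) • Quark.firstWeight (Quark.diagWeight d))
      (Quark.integralRadius (Quark.diagWeight d)) d :=
    { antitone := hd
      trace := hd0
      pos := Quark.integralRadius_pos hξ
      weight := fun s => by
        rw [Quark.firstWeight, smul_smul, Quark.smul_diagWeight] }
  exact ⟨fun s hs =>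
    ⟨(Q s).isBerezin_univBerezin hd hd0 (hray.scale_pos hs) (hray.weight s),
      (Q s).twistedProdWellDefined_univBerezin hd hd0 (hray.scale_pos hs) (hray.weight s)⟩,
    hray.isPoissonType rfl Q⟩
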